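/- For functions $u(x,t)$ and parameters $h>0$, $\tau>0$, $\nu\ge 0$ put $$g_1=-\Big(\frac{u^2}{2}\Big)_x+\nu u_{xx},\qquad g_2=(-g_1u)_x+\nu (g_1)_{xx},\qquad g_3=(-g_2u-g_1^2)_x+\nu (g_2)_{xx}.$$ The first differential approximations $\mathcal P=0$ of the three classical difference schemes for the Burgers equation $u_t+uu_x-\nu u_{xx}=0$ with mesh size $h$ and time step $\tau$ are, with $$\mathcal P_0=u_t+\tfrac12(u^2)_x-\nu u_{xx}+\tfrac{h^2}{12}(u^2)_{xxx}-\tfrac{\nu h^2}{12}u_{xxxx},$$ * FTCS: $\mathcal P=\mathcal P_0+\frac{\tau}{2}g_2$ (order $l'=4$); * Lax–Wendroff: $\mathcal P=\mathcal P_0+\frac{\tau^2}{6}g_3$ (order $l'=6$); * Crank–Nicolson: $\mathcal P=\mathcal P_0+\tau^2\big(\frac{g_3}{6}+\frac14(g_1^2+ug_2)_x-\frac{\nu}{4}(g_2)_{xx}\big)$ (order $l'=6$). Consider smooth infinitesimal operators $$\mathbf L=\xi_1\partial_x+\xi_2\partial_t+\eta\,\partial_u+\zeta_1\partial_h+\zeta_2\partial_\tau+\theta\,\partial_\nu$$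 on the space of the variables $(x,t,u,h,\tau,\nu)$ with $x,t,u\in\mathbb R$, $h,\tau>0$, $\nu\ge0$, where $\xi_1,\xi_2,\eta$ are functions of $(x,t,u)$ and $\zeta_1,\zeta_2,\theta$ are functions of all six variables. Let $\widetilde{\mathbf L}^{(l)}$ be the $l$-th prolongation of $\mathbf L$ to the derivatives of $u$ with respect to $x$ and $t$ (in the total derivatives $h,\tau,\nu$ are constants). $\mathbf L$ is called an infinitesimal symmetry of an equation $\mathcal P=0$ of order $l$ if it solves the determining equations $\widetilde{\mathbf L}^{(l)}\mathcal P\big|_{\mathcal P=0}=0$. Then for each of the three first differential approximations: 1. The infinitesimal symmetries are exactly the operators $$\xi_1=a+bx,\quad \xi_2=c+(2b-d)t,\quad \eta=(d-b)u,\quad \zeta_1=bh,\quad \zeta_2=(2b-d)\tau,\quad \theta=d\,\nu,$$ with $a,b,c,d\in\mathbb R$ uniquely determined. That is, they form the $4$-dimensional space spanned by $$\partial_x,\quad \partial_t,\quad x\partial_x+2t\partial_t-u\partial_u+h\partial_h+2\tau\partial_\tau,\quad -t\partial_t+u\partial_u-\tau\partial_\tau+\nu\partial_\nu .$$ 2.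 The group of transformations of this space generated by the one-parameter groups of the infinitesimal symmetries is the $4$-parameter group of the maps $$(x,t,u,h,\tau,\nu)\mapsto\Big(\lambda x+\alpha,\ \tfrac{\lambda^2}{\mu}t+\gamma,\ \tfrac{\mu}{\lambda}u,\ \lambda h,\ \tfrac{\lambda^2}{\mu}\tau,\ \mu\nu\Big),\qquad \alpha,\gamma\in\mathbb R,\ \lambda,\mu>0,$$ the four parameters being uniquely determined by the map. 3. The projective and Galilean symmetries of the Burgers equation are lost. The Burgers equation has the infinitesimal symmetries $\mathbf L_1=\partial_x$, $\mathbf L_2=\partial_t$, $\mathbf L_3=x\partial_x+2t\partial_t-u\partial_u$, $\mathbf L_4=xt\partial_x+t^2\partial_t+(x-tu)\partial_u$ (projective), $\mathbf L_5=t\partial_x+\partial_u$ (Galilean), $\mathbf L_6=-t\partial_t+u\partial_u+\nu\partial_\nu$. The first differential approximation has an infinitesimal symmetry with the same $\partial_x,\partial_t,\partial_u$ components as $\sum_i c_i\mathbf L_i$ (and arbitrary $\partial_h,\partial_\tau,\partial_\nu$ components) if and only if $c_4=c_5=0$. -/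

import Mathlib

open scoped ContDiff

noncomputable section

namespace BurgersFDA

/-- Coordinates of the jet space: the independent variables `x`, `t`, the steps `h`, `tau`, the
viscosity `nu`, and `u i j`, which stands for `∂_x^i ∂_t^j u` (so `u 0 0` is `u` itself). -/
inductive Coord where
  | x | t | h | tau | nu
  | u (i j : ℕ)
  deriving DecidableEq

open Coord

/-- The jet space. -/
abbrev Jet : Type := Coord → ℝ

/-- The partial derivative with respect to one coordinate of the jet space. -/
def pd (c : Coord) (F : Jet → ℝ) (z : Jet) : ℝ :=
  deriv (fun s : ℝ => F (Function.update z c s)) (z c)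

/-- The sum of `f i j` over all derivatives `∂_x^i ∂_t^j` of order `i + j ≤ n`. -/
def jetSum (n : ℕ) (f : ℕ → ℕ → ℝ) : ℝ :=
  ∑ i ∈ Finset.range (n + 1), ∑ j ∈ Finset.range (n + 1 - i), f i j

/-- The total derivative in `x`. The steps and the viscosity are constants for it. It is only
applied to functions of jets of order at most `6`, which is why the sum may stop there. -/
def Dx (F : Jet → ℝ) (z : Jet) : ℝ :=
  pd x F z + jetSum 6 fun i j => z (u (i + 1) j) * pd (u i j) F z

/-- The total derivative in `t`. -/
def Dt (F : Jet → ℝ) (z : Jet) : ℝ :=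
  pd t F z + jetSum 6 fun i j => z (u i (j + 1)) * pd (u i j) F z

/-! ### The equations -/

/-- The left-hand side `u_t + u u_x - ν u_xx` of the Burgers equation. -/
def burgers (z : Jet) : ℝ :=
  z (u 0 1) + z (u 0 0) * z (u 1 0) - z nu * z (u 2 0)

/-- `g₁ = -(u²/2)_x + ν u_xx` -/
def g₁ (z : Jet) : ℝ :=
  -Dx (fun w => w (u 0 0) ^ 2 / 2) z + z nu * z (u 2 0)

/-- `g₂ = (-g₁ u)_x + ν (g₁)_xx` -/
def g₂ (z : Jet) : ℝ :=
  Dx (fun w => -g₁ w * w (u 0 0)) z + z nu * Dx (Dx g₁) z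

/-- `g₃ = (-g₂ u - g₁²)_x + ν (g₂)_xx` -/
def g₃ (z : Jet) : ℝ :=
  Dx (fun w => -g₂ w * w (u 0 0) - g₁ w ^ 2) z + z nu * Dx (Dx g₂) z

/-- The part common to the three differential approximations:
`u_t + (u²)_x / 2 - ν u_xx + (h²/12) (u²)_xxx - (ν h²/12) u_xxxx`. -/
def commonPart (z : Jet) : ℝ :=
  z (u 0 1) + 1 / 2 * Dx (fun w => w (u 0 0) ^ 2) z - z nu * z (u 2 0)
    + z h ^ 2 / 12 * Dx (Dx (Dx fun w => w (u 0 0) ^ 2)) z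
    - z nu * z h ^ 2 / 12 * z (u 4 0)

/-- The three difference schemes. -/
inductive Scheme where
  | ftcs | laxWendroff | crankNicolson

/-- The left-hand side of the first differential approximation of a scheme. -/
def fda : Scheme → Jet → ℝ
  | .ftcs => fun z => commonPart z + z tau / 2 * g₂ z
  | .laxWendroff => fun z => commonPart z + z tau ^ 2 / 6 * g₃ z
  | .crankNicolson => fun z => commonPart z
      + z tau ^ 2 * (g₃ z / 6 + 1 / 4 * Dx (fun w => g₁ w ^ 2 + w (u 0 0) * g₂ w) z
          - z nu / 4 * Dx (Dx g₂) z)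

/-- The order of the first differential approximation of a scheme. -/
def fdaOrder : Scheme → ℕ
  | .ftcs => 4
  | .laxWendroff => 6
  | .crankNicolson => 6

/-! ### Infinitesimal transformations -/

/-- A point `((x, t, u), (h, τ, ν))`. -/
abbrev Point : Type := (ℝ × ℝ × ℝ) × (ℝ × ℝ × ℝ)

/-- The admissible values of `(h, τ, ν)`. -/
def params : Set (ℝ × ℝ × ℝ) := {p | 0 < p.1 ∧ 0 < p.2.1 ∧ 0 ≤ p.2.2}

/-- The space of the variables `x, t, u, h, τ, ν`. -/
def phaseSpace : Set Point := Set.univ ×ˢ params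

/-- An infinitesimal operator
`ξ₁ ∂_x + ξ₂ ∂_t + η ∂_u + ζ₁ ∂_h + ζ₂ ∂_τ + θ ∂_ν`, where `ξ₁, ξ₂, η` are functions of `(x, t, u)`
and `ζ₁, ζ₂, θ` are functions of `((x, t, u), (h, τ, ν))`. -/
structure PointField where
  xi₁ : ℝ × ℝ × ℝ → ℝ
  xi₂ : ℝ × ℝ × ℝ → ℝ
  eta : ℝ × ℝ × ℝ → ℝ
  zeta₁ : Point → ℝ
  zeta₂ : Point → ℝ
  theta : Point → ℝ

namespace PointField

/-- The vector of the coefficients at a point. -/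
def val (V : PointField) (p : Point) : Point :=
  ((V.xi₁ p.1, V.xi₂ p.1, V.eta p.1), (V.zeta₁ p, V.zeta₂ p, V.theta p))

/-- All coefficients are smooth on the space of the variables. -/
def IsSmooth (V : PointField) : Prop :=
  ContDiff ℝ ∞ V.xi₁ ∧ ContDiff ℝ ∞ V.xi₂ ∧ ContDiff ℝ ∞ V.eta ∧
    ContDiffOn ℝ ∞ V.zeta₁ phaseSpace ∧ ContDiffOn ℝ ∞ V.zeta₂ phaseSpace ∧
    ContDiffOn ℝ ∞ V.theta phaseSpace

end PointField

/-- The value of `(x, t, u)` at a jet. -/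
def base (z : Jet) : ℝ × ℝ × ℝ := (z x, z t, z (u 0 0))

/-- The value of `(h, τ, ν)` at a jet. -/
def par (z : Jet) : ℝ × ℝ × ℝ := (z h, z tau, z nu)

/-- The coefficient `σ` of `∂/∂u_{ij}` in the prolongation of `V`, with `σ 0 0 = η`. -/
def sigma (V : PointField) : ℕ → ℕ → Jet → ℝ
  | 0, 0 => fun z => V.eta (base z)
  | 0, j + 1 => fun z => Dt (sigma V 0 j) z
      - z (u 1 j) * Dt (fun w => V.xi₁ (base w)) z
      - z (u 0 (j + 1)) * Dt (fun w => V.xi₂ (base w)) z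
  | i + 1, j => fun z => Dx (sigma V i j) z
      - z (u (i + 1) j) * Dx (fun w => V.xi₁ (base w)) z
      - z (u i (j + 1)) * Dx (fun w => V.xi₂ (base w)) z

/-- The prolongation of order `n` of `V`, acting on a function on the jet space. -/
def prolong (n : ℕ) (V : PointField) (F : Jet → ℝ) (z : Jet) : ℝ :=
  V.xi₁ (base z) * pd x F z + V.xi₂ (base z) * pd t F z
    + V.zeta₁ (base z, par z) * pd h F z + V.zeta₂ (base z, par z) * pd tau F z
    + V.theta (base z, par z) * pd nu F z
    + jetSum n fun i j => sigma V i j z * pd (u i j) F z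

/-- `V` is a smooth solution of the determining equations of the equation `P = 0` of order `n`:
the prolongation of `V` annihilates `P` wherever `P` vanishes. -/
def IsSymmetry (n : ℕ) (P : Jet → ℝ) (V : PointField) : Prop :=
  V.IsSmooth ∧ ∀ z : Jet, par z ∈ params → P z = 0 → prolong n V P z = 0

/-! ### Transformation groups -/

/-- `φ` is a one-parameter group of transformations of the space of the variables whose
infinitesimal operator is `V`. -/
def IsFlow (V : PointField) (φ : ℝ → Equiv.Perm phaseSpace) : Prop :=
  (∀ s r, φ (s + r) = φ s * φ r) ∧
    ∀ (p : phaseSpace) (s : ℝ), HasDerivAt (fun r => (φ r p : Point)) (V.val (φ s p)) s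

/-- The group generated by the one-parameter groups whose infinitesimal operators solve the
determining equations of `P = 0`. -/
def symmetryGroup (n : ℕ) (P : Jet → ℝ) : Subgroup (Equiv.Perm phaseSpace) :=
  Subgroup.closure {g | ∃ V, IsSymmetry n P V ∧ ∃ φ, IsFlow V φ ∧ ∃ s, g = φ s}

/-- The transformation `(x, t, u, h, τ, ν) ↦
(l x + a, (l²/m) t + c, (m/l) u, l h, (l²/m) τ, m ν)`. -/
def transform (a c l m : ℝ) (p : Point) : Point :=
  ((l * p.1.1 + a, l ^ 2 / m * p.1.2.1 + c, m / l * p.1.2.2),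
    (l * p.2.1, l ^ 2 / m * p.2.2.1, m * p.2.2.2))

/-! ### Particular infinitesimal operators -/

/-- `∂_x` -/
def transX : PointField := ⟨fun _ => 1, fun _ => 0, fun _ => 0, fun _ => 0, fun _ => 0, fun _ => 0⟩

/-- `∂_t` -/
def transT : PointField := ⟨fun _ => 0, fun _ => 1, fun _ => 0, fun _ => 0, fun _ => 0, fun _ => 0⟩

/-- `x ∂_x + 2 t ∂_t - u ∂_u + h ∂_h + 2 τ ∂_τ` -/
def dilX : PointField where
  xi₁ := fun p => p.1
  xi₂ := fun p => 2 * p.2.1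
  eta := fun p => -p.2.2
  zeta₁ := fun p => p.2.1
  zeta₂ := fun p => 2 * p.2.2.1
  theta := fun _ => 0

/-- `-t ∂_t + u ∂_u - τ ∂_τ + ν ∂_ν` -/
def dilT : PointField where
  xi₁ := fun _ => 0
  xi₂ := fun p => -p.2.1
  eta := fun p => p.2.2
  zeta₁ := fun _ => 0
  zeta₂ := fun p => -p.2.2.1
  theta := fun p => p.2.2.2

/-- The six generators of the symmetries of the Burgers equation, in this order:
`∂_x`, `∂_t`, `x ∂_x + 2 t ∂_t - u ∂_u`, the projective one `x t ∂_x + t² ∂_t + (x - t u) ∂_u`,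
the Galilean one `t ∂_x + ∂_u`, and `-t ∂_t + u ∂_u + ν ∂_ν`. -/
def burgersGen : Fin 6 → PointField :=
  ![transX, transT,
    ⟨fun p => p.1, fun p => 2 * p.2.1, fun p => -p.2.2, fun _ => 0, fun _ => 0, fun _ => 0⟩,
    ⟨fun p => p.1 * p.2.1, fun p => p.2.1 ^ 2, fun p => p.1 - p.2.1 * p.2.2,
      fun _ => 0, fun _ => 0, fun _ => 0⟩,
    ⟨fun p => p.2.1, fun _ => 0, fun _ => 1, fun _ => 0, fun _ => 0, fun _ => 0⟩,
    ⟨fun _ => 0, fun p => -p.2.1, fun p => p.2.2, fun _ => 0, fun _ => 0, fun p => p.2.2.2⟩]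

end BurgersFDA

end

/-! Each of the three equations has the evolution form `u_t + Q = 0` with `Q = evol κ₁ κ₂`, a
polynomial in the x-derivatives of `u`. The pair `(κ₁, κ₂)` is `(1/2, 0)` for FTCS, `(0, 1/6)` for
Lax–Wendroff and `(0, -1/12)` for Crank–Nicolson. One argument therefore serves all schemes. It uses
only the two highest coefficients of `Q`, recorded in `HasLeading`, and a few values of `Q` at
special jets.

The determining equations are split by the jet variables. Let `m + 1` be the order of `Q` in `x`.
The coefficient of the mixed derivative `u_{m,1}` is a multiple of `D_x ξ₂`, so `ξ₂` depends on `t`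
only (`Dx_xi₂_eq_zero`). After that `u_t` can be eliminated, and an identity on the free x-jets
remains (`detEq`). Its coefficient of `u_{m+1}` gives `∂_u ξ₁ = 0` (`du_xi₁_eq_zero`). Its
coefficient of `u_m` makes `η` affine in `u`, with `η = 0` and `2 η_xu = m ξ₁_xx` at `u = 0`
(`eta_relations`).

At jets with `u = ν = 0`, the dispersion term `(h²/12)(u²)_xxx` yields `(h²/2)(2 η_xu - ξ₁_xx) =
ξ₁_t` for every `h > 0`. Hence both sides vanish, and as `m ≠ 1` so do `ξ₁_xx` and `η_xu`
(`xi₁_eta_relations`). This is where the projective and Galilean fields die, since they have `ξ₁_t ≠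
0`. What remains is a polynomial identity in `u_x` and `u_xx` (`detEq_explicit`), whose coefficients
give `ξ₂_t`, `ζ₁`, `ζ₂` and `θ` in terms of the constants `ξ₁_x` and `η_u`.

Conversely, the four fields are translations and scalings under which the equation is homogeneous.
Their flows are integrated explicitly, and every stated transformation is a translation composed
with a scaling. -/

noncomputable section

set_option linter.unusedSimpArgs false

namespace BurgersFDA

open Coord

/-! ### Differential functions -/

/-- Polynomials in the jet coordinates with coefficients that are smooth functions of
`(x, t, u)`. -/
inductive JetSmooth : (Jet → ℝ) → Prop
  | const (a : ℝ) : JetSmooth fun _ => a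
  | coord (c : Coord) : JetSmooth fun z => z c
  | base (f : ℝ × ℝ × ℝ → ℝ) (hf : ContDiff ℝ ∞ f) : JetSmooth fun z => f (base z)
  | add (F G : Jet → ℝ) : JetSmooth F → JetSmooth G → JetSmooth fun z => F z + G z
  | mul (F G : Jet → ℝ) : JetSmooth F → JetSmooth G → JetSmooth fun z => F z * G z

/-- The `(x, t, u)` part of the coordinate vector of `c`. -/
def baseDir (c : Coord) : ℝ × ℝ × ℝ := base (Pi.single c 1)

theorem base_update (z : Jet) (c : Coord) (s : ℝ) :
    base (Function.update z c s) = base z + (s - z c) • baseDir c := by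
  have key : ∀ d : Coord, Function.update z c s d
      = z d + (s - z c) * (Pi.single c 1 : Jet) d := by
    intro d
    by_cases h : d = c
    · subst h; simp
    · simp [h]
  simp [base, baseDir, key]

theorem hasDerivAt_base_update {f : ℝ × ℝ × ℝ → ℝ} (hf : ContDiff ℝ ∞ f) (c : Coord) (z : Jet) :
    HasDerivAt (fun s => f (base (Function.update z c s))) (fderiv ℝ f (base z) (baseDir c))
      (z c) := by
  have h1 : HasDerivAt (fun s => base (Function.update z c s)) (baseDir c) (z c) := by
    simp only [base_update]
    have := (((hasDerivAt_id (z c)).sub_const (z c)).smul_const (baseDir c)).const_add (base z)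
    simpa using this
  have h2 : HasFDerivAt f (fderiv ℝ f (base z)) (base (Function.update z c (z c))) := by
    rw [Function.update_eq_self]
    exact (hf.differentiable (by simp) _).hasFDerivAt
  exact h2.comp_hasDerivAt (z c) h1

theorem hasDerivAt_coord_update (c d : Coord) (z : Jet) :
    HasDerivAt (fun s => Function.update z c s d) (if d = c then 1 else 0) (z c) := by
  by_cases h : d = c
  · subst h; simpa using hasDerivAt_id' (z d)
  · simpa [h] using hasDerivAt_const (z c) (z d)

theorem JetSmooth.hasDerivAt {F : Jet → ℝ} (hF : JetSmooth F) (c : Coord) (z : Jet) :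
    HasDerivAt (fun s => F (Function.update z c s)) (pd c F z) (z c) := by
  apply DifferentiableAt.hasDerivAt
  induction hF with
  | const a => fun_prop
  | coord d => exact (hasDerivAt_coord_update c d z).differentiableAt
  | base f hf => exact (hasDerivAt_base_update hf c z).differentiableAt
  | add F G _ _ h1 h2 => exact h1.fun_add h2
  | mul F G _ _ h1 h2 => exact h1.fun_mul h2

theorem pd_eq_of_hasDerivAt {F : Jet → ℝ} {c : Coord} {z : Jet} {a : ℝ}
    (h : HasDerivAt (fun s => F (Function.update z c s)) a (z c)) : pd c F z = a :=
  h.deriv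

@[simp] theorem pd_const (c : Coord) (a : ℝ) : pd c (fun _ => a) = fun _ => 0 := by
  funext z; simp [pd]

theorem pd_coord (c d : Coord) : pd c (fun z => z d) = fun _ => if d = c then 1 else 0 := by
  funext z; exact pd_eq_of_hasDerivAt (hasDerivAt_coord_update c d z)

theorem pd_base {f : ℝ × ℝ × ℝ → ℝ} (hf : ContDiff ℝ ∞ f) (c : Coord) :
    pd c (fun z => f (base z)) = fun z => fderiv ℝ f (base z) (baseDir c) := by
  funext z; exact pd_eq_of_hasDerivAt (hasDerivAt_base_update hf c z)

theorem pd_add {F G : Jet → ℝ} (hF : JetSmooth F) (hG : JetSmooth G) (c : Coord) :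
    pd c (fun z => F z + G z) = fun z => pd c F z + pd c G z := by
  funext z; exact pd_eq_of_hasDerivAt ((hF.hasDerivAt c z).fun_add (hG.hasDerivAt c z))

theorem pd_mul {F G : Jet → ℝ} (hF : JetSmooth F) (hG : JetSmooth G) (c : Coord) :
    pd c (fun z => F z * G z) = fun z => pd c F z * G z + F z * pd c G z := by
  funext z
  have := (hF.hasDerivAt c z).fun_mul (hG.hasDerivAt c z)
  simp only [Function.update_eq_self] at this
  exact pd_eq_of_hasDerivAt this

namespace JetSmooth

theorem neg {F : Jet → ℝ} (hF : JetSmooth F) : JetSmooth fun z => -F z := by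
  simpa using mul _ _ (const (-1)) hF

theorem sub {F G : Jet → ℝ} (hF : JetSmooth F) (hG : JetSmooth G) :
    JetSmooth fun z => F z - G z := by
  simpa [sub_eq_add_neg] using add _ _ hF hG.neg

theorem pow {F : Jet → ℝ} (hF : JetSmooth F) (n : ℕ) : JetSmooth fun z => F z ^ n := by
  induction n with
  | zero => simpa using const 1
  | succ n ih => simpa [pow_succ] using mul _ _ ih hF

theorem div_const {F : Jet → ℝ} (hF : JetSmooth F) (a : ℝ) : JetSmooth fun z => F z / a := by
  simpa [div_eq_mul_inv] using mul _ _ hF (const a⁻¹)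

theorem sum {ι : Type*} (s : Finset ι) {F : ι → Jet → ℝ} (hF : ∀ i ∈ s, JetSmooth (F i)) :
    JetSmooth fun z => ∑ i ∈ s, F i z := by
  classical
  induction s using Finset.induction_on with
  | empty => simpa using const 0
  | insert a s ha ih =>
    simp only [Finset.sum_insert ha]
    exact add _ _ (hF a (by simp)) (ih fun i hi => hF i (by simp [hi]))

theorem jetSum (n : ℕ) {F : ℕ → ℕ → Jet → ℝ} (hF : ∀ i j, JetSmooth (F i j)) :
    JetSmooth fun z => jetSum n fun i j => F i j z :=
  sum _ fun i _ => sum _ fun j _ => hF i j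

theorem contDiff_fderiv_apply {f : ℝ × ℝ × ℝ → ℝ} (hf : ContDiff ℝ ∞ f) (v : ℝ × ℝ × ℝ) :
    ContDiff ℝ ∞ fun p => fderiv ℝ f p v :=
  (hf.fderiv_right (m := ∞) (by simp)).clm_apply contDiff_const

theorem pd {F : Jet → ℝ} (hF : JetSmooth F) (c : Coord) : JetSmooth (pd c F) := by
  induction hF with
  | const a => simpa using const 0
  | coord d => rw [pd_coord]; exact const _
  | base f hf => rw [pd_base hf]; exact base _ (contDiff_fderiv_apply hf _)
  | add F G hF hG h1 h2 => rw [pd_add hF hG]; exact add _ _ h1 h2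
  | mul F G hF hG h1 h2 =>
    rw [pd_mul hF hG]; exact add _ _ (mul _ _ h1 hG) (mul _ _ hF h2)

theorem Dx {F : Jet → ℝ} (hF : JetSmooth F) : JetSmooth (Dx F) :=
  add _ _ (hF.pd x) (jetSum 6 fun _ _ => mul _ _ (coord _) (hF.pd _))

theorem Dt {F : Jet → ℝ} (hF : JetSmooth F) : JetSmooth (Dt F) :=
  add _ _ (hF.pd t) (jetSum 6 fun _ _ => mul _ _ (coord _) (hF.pd _))

end JetSmooth

theorem pd_neg {F : Jet → ℝ} (hF : JetSmooth F) (c : Coord) :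
    pd c (fun z => -F z) = fun z => -pd c F z := by
  have := pd_mul (.const (-1)) hF c
  simpa using this

theorem pd_sub {F G : Jet → ℝ} (hF : JetSmooth F) (hG : JetSmooth G) (c : Coord) :
    pd c (fun z => F z - G z) = fun z => pd c F z - pd c G z := by
  have := pd_add hF hG.neg c
  rw [pd_neg hG] at this
  simpa [sub_eq_add_neg] using this

theorem pd_pow {F : Jet → ℝ} (hF : JetSmooth F) (n : ℕ) (c : Coord) :
    pd c (fun z => F z ^ n) = fun z => n * F z ^ (n - 1) * pd c F z := by
  funext z
  have := (hF.hasDerivAt c z).fun_pow n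
  simp only [Function.update_eq_self] at this
  exact pd_eq_of_hasDerivAt this

theorem pd_div {F : Jet → ℝ} (hF : JetSmooth F) (a : ℝ) (c : Coord) :
    pd c (fun z => F z / a) = fun z => pd c F z / a := by
  funext z
  exact pd_eq_of_hasDerivAt ((hF.hasDerivAt c z).div_const a)

theorem pd_sum {ι : Type*} (s : Finset ι) {F : ι → Jet → ℝ} (hF : ∀ i, JetSmooth (F i))
    (c : Coord) : pd c (fun z => ∑ i ∈ s, F i z) = fun z => ∑ i ∈ s, pd c (F i) z := by
  classical
  induction s using Finset.induction_on with
  | empty => simp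
  | insert a s ha ih =>
    simp only [Finset.sum_insert ha]
    rw [pd_add (hF a) (.sum _ fun i _ => hF i), ih]

theorem pd_jetSum (n : ℕ) {F : ℕ → ℕ → Jet → ℝ} (hF : ∀ i j, JetSmooth (F i j)) (c : Coord) :
    pd c (fun z => jetSum n fun i j => F i j z) = fun z => jetSum n fun i j => pd c (F i j) z := by
  simp only [jetSum]
  rw [pd_sum _ fun i => .sum _ fun j _ => hF i j]
  funext z
  exact Finset.sum_congr rfl fun i _ => by rw [pd_sum _ fun j => hF i j]

theorem fderiv_fderiv_comm {f : ℝ × ℝ × ℝ → ℝ} (hf : ContDiff ℝ ∞ f) (p v w : ℝ × ℝ × ℝ) :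
    fderiv ℝ (fun q => fderiv ℝ f q v) p w = fderiv ℝ (fun q => fderiv ℝ f q w) p v := by
  have hd : DifferentiableAt ℝ (fderiv ℝ f) p :=
    (hf.fderiv_right (m := ∞) (by simp)).differentiable (by simp) _
  have hs : IsSymmSndFDerivAt ℝ f p :=
    hf.contDiffAt.isSymmSndFDerivAt (by
      simpa using (by exact_mod_cast le_top : ((2 : ℕ∞) : WithTop ℕ∞) ≤ ∞))
  rw [fderiv_clm_apply hd (differentiableAt_const _),
    fderiv_clm_apply hd (differentiableAt_const _)]
  simpa using hs.eq w v

/-- Partial derivatives commute. -/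
theorem pd_comm {F : Jet → ℝ} (hF : JetSmooth F) (c d : Coord) :
    pd c (pd d F) = pd d (pd c F) := by
  induction hF with
  | const a => simp
  | coord e => simp [pd_coord]
  | base f hf =>
    rw [pd_base hf, pd_base hf, pd_base (JetSmooth.contDiff_fderiv_apply hf _),
      pd_base (JetSmooth.contDiff_fderiv_apply hf _)]
    funext z
    exact fderiv_fderiv_comm hf (base z) _ _
  | add F G hF hG h1 h2 =>
    rw [pd_add hF hG, pd_add hF hG, pd_add (hF.pd _) (hG.pd _), pd_add (hF.pd _) (hG.pd _), h1, h2]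
  | mul F G hF hG h1 h2 =>
    rw [pd_mul hF hG, pd_mul hF hG, pd_add (.mul _ _ (hF.pd _) hG) (.mul _ _ hF (hG.pd _)),
      pd_add (.mul _ _ (hF.pd _) hG) (.mul _ _ hF (hG.pd _)), pd_mul (hF.pd _) hG,
      pd_mul hF (hG.pd _), pd_mul (hF.pd _) hG, pd_mul hF (hG.pd _), h1, h2]
    funext z; ring

/-- A differential function whose derivative in a coordinate vanishes does not depend on it. -/
theorem JetSmooth.update_eq {F : Jet → ℝ} (hF : JetSmooth F) {c : Coord}
    (h : BurgersFDA.pd c F = fun _ => 0) (z : Jet) (s : ℝ) : F (Function.update z c s) = F z := by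
  have hd : ∀ r, HasDerivAt (fun s => F (Function.update z c s)) 0 r := by
    intro r
    have := hF.hasDerivAt c (Function.update z c r)
    simpa [h] using this
  have := is_const_of_deriv_eq_zero (fun r => (hd r).differentiableAt) (fun r => (hd r).deriv)
    s (z c)
  simpa using this

/-- The second alternative in `hij` covers an index outside the range of the sum: the term is then
missing on the left and zero on the right. -/
theorem jetSum_single {n i j : ℕ} {f : ℕ → ℕ → ℝ} (h : ∀ k l, (k, l) ≠ (i, j) → f k l = 0)
    (hij : i + j ≤ n ∨ f i j = 0) : jetSum n f = f i j := by
  unfold jetSum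
  rw [Finset.sum_eq_single i, Finset.sum_eq_single j]
  · intro l _ hl; exact h _ _ (by simp [hl])
  · intro hj
    rcases hij with hij | hij
    · simp at hj; omega
    · exact hij
  · intro k _ hk; exact Finset.sum_eq_zero fun l _ => h _ _ (by simp [hk])
  · intro hi
    rcases hij with hij | hij
    · simp at hi; omega
    · exact Finset.sum_eq_zero fun l _ => by
        by_cases hl : l = j
        · rw [hl, hij]
        · exact h _ _ (by simp [hl])

theorem jetSum_zero (n : ℕ) : jetSum n (fun _ _ => 0) = 0 := by simp [jetSum]

theorem jetSum_add (n : ℕ) (f g : ℕ → ℕ → ℝ) :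
    (jetSum n fun i j => f i j + g i j) = jetSum n f + jetSum n g := by
  simp [jetSum, Finset.sum_add_distrib]

theorem jetSum_mul (n : ℕ) (a : ℝ) (f : ℕ → ℕ → ℝ) :
    (jetSum n fun i j => a * f i j) = a * jetSum n f := by
  simp [jetSum, Finset.mul_sum]

/-! ### Total derivatives -/

@[simp] theorem Dx_const (a : ℝ) : Dx (fun _ => a) = fun _ => 0 := by
  funext z; simp [Dx, jetSum_zero]

theorem Dx_add {F G : Jet → ℝ} (hF : JetSmooth F) (hG : JetSmooth G) :
    Dx (fun z => F z + G z) = fun z => Dx F z + Dx G z := by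
  funext z
  simp only [Dx, pd_add hF hG, mul_add, jetSum_add]
  ring

theorem Dx_mul {F G : Jet → ℝ} (hF : JetSmooth F) (hG : JetSmooth G) :
    Dx (fun z => F z * G z) = fun z => Dx F z * G z + F z * Dx G z := by
  funext z
  have : ∀ i j, z (u (i + 1) j) * (pd (u i j) F z * G z + F z * pd (u i j) G z)
      = G z * (z (u (i + 1) j) * pd (u i j) F z) + F z * (z (u (i + 1) j) * pd (u i j) G z) := by
    intros; ring
  simp only [Dx, pd_mul hF hG, this, jetSum_add, jetSum_mul]
  ring

theorem Dx_neg {F : Jet → ℝ} (hF : JetSmooth F) : Dx (fun z => -F z) = fun z => -Dx F z := by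
  simpa using Dx_mul (.const (-1)) hF

theorem Dx_sub {F G : Jet → ℝ} (hF : JetSmooth F) (hG : JetSmooth G) :
    Dx (fun z => F z - G z) = fun z => Dx F z - Dx G z := by
  have := Dx_add hF hG.neg
  rw [Dx_neg hG] at this
  simpa [sub_eq_add_neg] using this

/-- The bound is that of the truncated sum in `Dx`; beyond order 6 the total derivative of `u i j`
would be zero. -/
theorem Dx_u {i j : ℕ} (h : i + j ≤ 6) : Dx (fun z => z (u i j)) = fun z => z (u (i + 1) j) := by
  funext z
  rw [Dx, pd_coord, jetSum_single (i := i) (j := j)]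
  · simp [pd_coord]
  · intro k l hkl; simp only [pd_coord]; grind
  · exact .inl h

theorem Dx_nu : Dx (fun z => z nu) = fun _ => 0 := by
  funext z; simp [Dx, pd_coord, jetSum_zero]

/-- The commutator of `∂/∂u_{i+1,j}` with `D_x` is `∂/∂u_{ij}`, coming from the one summand of `D_x`
with factor `u_{i+1,j}`. The hypothesis says that this summand survives truncation or vanishes
anyway. All induction on prolongation coefficients below rests on this rule. -/
theorem pd_u_Dx {F : Jet → ℝ} (hF : JetSmooth F) {i j : ℕ}
    (h : i + j ≤ 6 ∨ pd (u i j) F = fun _ => 0) :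
    pd (u (i + 1) j) (Dx F) = fun z => Dx (pd (u (i + 1) j) F) z + pd (u i j) F z := by
  funext z
  unfold Dx
  rw [pd_add (hF.pd x) (.jetSum 6 fun _ _ => .mul _ _ (.coord _) (hF.pd _)),
    pd_jetSum 6 fun _ _ => .mul _ _ (.coord _) (hF.pd _)]
  simp only [pd_mul (.coord _) (hF.pd _), pd_comm hF (u (i + 1) j), jetSum_add, pd_coord]
  rw [jetSum_single (i := i) (j := j)]
  · simp; ring
  · intro k l hkl; simp; grind
  · exact h.imp id fun h => by simp [h]

/-- No summand of `D_x` has a factor `u_{0,j}`, so there is no commutator term. -/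
theorem pd_u_zero_Dx {F : Jet → ℝ} (hF : JetSmooth F) (j : ℕ) :
    pd (u 0 j) (Dx F) = Dx (pd (u 0 j) F) := by
  funext z
  unfold Dx
  rw [pd_add (hF.pd x) (.jetSum 6 fun _ _ => .mul _ _ (.coord _) (hF.pd _)),
    pd_jetSum 6 fun _ _ => .mul _ _ (.coord _) (hF.pd _)]
  simp only [pd_mul (.coord _) (hF.pd _), pd_comm hF (u 0 j), jetSum_add, pd_coord]
  simp [jetSum_zero]

/-! ### Functions of `(x, t, u)` -/

/-- The partial derivative in `x` of a function of `(x, t, u)`. -/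
def dx (f : ℝ × ℝ × ℝ → ℝ) (p : ℝ × ℝ × ℝ) : ℝ := fderiv ℝ f p (1, 0, 0)

/-- The partial derivative in `t` of a function of `(x, t, u)`. -/
def dt (f : ℝ × ℝ × ℝ → ℝ) (p : ℝ × ℝ × ℝ) : ℝ := fderiv ℝ f p (0, 1, 0)

/-- The partial derivative in `u` of a function of `(x, t, u)`. -/
def du (f : ℝ × ℝ × ℝ → ℝ) (p : ℝ × ℝ × ℝ) : ℝ := fderiv ℝ f p (0, 0, 1)

theorem contDiff_dx {f : ℝ × ℝ × ℝ → ℝ} (hf : ContDiff ℝ ∞ f) : ContDiff ℝ ∞ (dx f) :=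
  JetSmooth.contDiff_fderiv_apply hf _

theorem contDiff_dt {f : ℝ × ℝ × ℝ → ℝ} (hf : ContDiff ℝ ∞ f) : ContDiff ℝ ∞ (dt f) :=
  JetSmooth.contDiff_fderiv_apply hf _

theorem contDiff_du {f : ℝ × ℝ × ℝ → ℝ} (hf : ContDiff ℝ ∞ f) : ContDiff ℝ ∞ (du f) :=
  JetSmooth.contDiff_fderiv_apply hf _

theorem pd_base_x {f : ℝ × ℝ × ℝ → ℝ} (hf : ContDiff ℝ ∞ f) :
    pd x (fun z => f (base z)) = fun z => dx f (base z) := by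
  rw [pd_base hf]; simp [baseDir, base, dx]

theorem pd_base_t {f : ℝ × ℝ × ℝ → ℝ} (hf : ContDiff ℝ ∞ f) :
    pd t (fun z => f (base z)) = fun z => dt f (base z) := by
  rw [pd_base hf]; simp [baseDir, base, dt]

theorem pd_base_u {f : ℝ × ℝ × ℝ → ℝ} (hf : ContDiff ℝ ∞ f) :
    pd (u 0 0) (fun z => f (base z)) = fun z => du f (base z) := by
  rw [pd_base hf]; simp [baseDir, base, du]

theorem pd_base_u_of_ne {f : ℝ × ℝ × ℝ → ℝ} (hf : ContDiff ℝ ∞ f) {i j : ℕ}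
    (h : (i, j) ≠ (0, 0)) : pd (u i j) (fun z => f (base z)) = fun _ => 0 := by
  have : u 0 0 ≠ u i j := by simpa [eq_comm] using h
  rw [pd_base hf]; simp [baseDir, base, this, ← Prod.zero_eq_mk]

theorem Dx_base {f : ℝ × ℝ × ℝ → ℝ} (hf : ContDiff ℝ ∞ f) :
    Dx (fun z => f (base z)) = fun z => dx f (base z) + z (u 1 0) * du f (base z) := by
  funext z
  rw [Dx, pd_base_x hf, jetSum_single (i := 0) (j := 0)]
  · simp [pd_base_u hf]
  · intro k l hkl; simp [pd_base_u_of_ne hf hkl]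
  · simp

theorem Dt_base {f : ℝ × ℝ × ℝ → ℝ} (hf : ContDiff ℝ ∞ f) :
    Dt (fun z => f (base z)) = fun z => dt f (base z) + z (u 0 1) * du f (base z) := by
  funext z
  rw [Dt, pd_base_t hf, jetSum_single (i := 0) (j := 0)]
  · simp [pd_base_u hf]
  · intro k l hkl; simp [pd_base_u_of_ne hf hkl]
  · simp

theorem dx_eq_deriv {f : ℝ × ℝ × ℝ → ℝ} (hf : ContDiff ℝ ∞ f) (p : ℝ × ℝ × ℝ) :
    HasDerivAt (fun s => f (s, p.2)) (dx f p) p.1 := by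
  have h : HasDerivAt (fun s : ℝ => (s, p.2)) (1, 0, 0) p.1 :=
    (hasDerivAt_id' p.1).prodMk (hasDerivAt_const _ _)
  exact (hf.differentiable (by simp) p).hasFDerivAt.comp_hasDerivAt p.1 h

theorem dt_eq_deriv {f : ℝ × ℝ × ℝ → ℝ} (hf : ContDiff ℝ ∞ f) (p : ℝ × ℝ × ℝ) :
    HasDerivAt (fun s => f (p.1, s, p.2.2)) (dt f p) p.2.1 := by
  have h : HasDerivAt (fun s : ℝ => (p.1, s, p.2.2)) (0, 1, 0) p.2.1 :=
    (hasDerivAt_const _ _).prodMk ((hasDerivAt_id' p.2.1).prodMk (hasDerivAt_const _ _))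
  exact (hf.differentiable (by simp) p).hasFDerivAt.comp_hasDerivAt p.2.1 h

theorem du_eq_deriv {f : ℝ × ℝ × ℝ → ℝ} (hf : ContDiff ℝ ∞ f) (p : ℝ × ℝ × ℝ) :
    HasDerivAt (fun s => f (p.1, p.2.1, s)) (du f p) p.2.2 := by
  have h : HasDerivAt (fun s : ℝ => (p.1, p.2.1, s)) (0, 0, 1) p.2.2 :=
    (hasDerivAt_const _ _).prodMk ((hasDerivAt_const _ _).prodMk (hasDerivAt_id' p.2.2))
  exact (hf.differentiable (by simp) p).hasFDerivAt.comp_hasDerivAt p.2.2 h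

theorem du_dx {f : ℝ × ℝ × ℝ → ℝ} (hf : ContDiff ℝ ∞ f) : du (dx f) = dx (du f) :=
  funext fun p => fderiv_fderiv_comm hf p _ _

theorem du_dt {f : ℝ × ℝ × ℝ → ℝ} (hf : ContDiff ℝ ∞ f) : du (dt f) = dt (du f) :=
  funext fun p => fderiv_fderiv_comm hf p _ _

theorem dx_dt {f : ℝ × ℝ × ℝ → ℝ} (hf : ContDiff ℝ ∞ f) : dx (dt f) = dt (dx f) :=
  funext fun p => fderiv_fderiv_comm hf p _ _

theorem dx_zero : dx (fun _ => 0) = fun _ => 0 := by funext p; simp [dx]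
theorem dt_zero : dt (fun _ => 0) = fun _ => 0 := by funext p; simp [dt]
theorem du_zero : du (fun _ => 0) = fun _ => 0 := by funext p; simp [du]

theorem eq_of_du_eq_zero {f : ℝ × ℝ × ℝ → ℝ} (hf : ContDiff ℝ ∞ f) (h : du f = fun _ => 0)
    (a b c d : ℝ) : f (a, b, c) = f (a, b, d) := by
  have hd : ∀ r, HasDerivAt (fun s => f (a, b, s)) 0 r := fun r => by
    simpa [h] using du_eq_deriv hf (a, b, r)
  exact is_const_of_deriv_eq_zero (fun r => (hd r).differentiableAt)
    (fun r => (hd r).deriv) c d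

theorem eq_of_dt_eq_zero {f : ℝ × ℝ × ℝ → ℝ} (hf : ContDiff ℝ ∞ f) (h : dt f = fun _ => 0)
    (a b c d : ℝ) : f (a, b, d) = f (a, c, d) := by
  have hd : ∀ r, HasDerivAt (fun s => f (a, s, d)) 0 r := fun r => by
    simpa [h] using dt_eq_deriv hf (a, r, d)
  exact is_const_of_deriv_eq_zero (fun r => (hd r).differentiableAt)
    (fun r => (hd r).deriv) b c

theorem eq_of_dx_eq_zero {f : ℝ × ℝ × ℝ → ℝ} (hf : ContDiff ℝ ∞ f) (h : dx f = fun _ => 0)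
    (a b c d : ℝ) : f (a, c, d) = f (b, c, d) := by
  have hd : ∀ r, HasDerivAt (fun s => f (s, c, d)) 0 r := fun r => by
    simpa [h] using dx_eq_deriv hf (r, c, d)
  exact is_const_of_deriv_eq_zero (fun r => (hd r).differentiableAt)
    (fun r => (hd r).deriv) a b

/-! ### The differential approximations in coordinates -/

/-- `g₂` in coordinates. -/
def g₂' (z : Jet) : ℝ :=
  2 * z (u 0 0) * z (u 1 0) ^ 2 + z (u 0 0) ^ 2 * z (u 2 0) - 4 * z nu * z (u 1 0) * z (u 2 0)
    - 2 * z nu * z (u 0 0) * z (u 3 0) + z nu ^ 2 * z (u 4 0)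

/-- `g₃` in coordinates. -/
def g₃' (z : Jet) : ℝ :=
  -6 * z (u 0 0) * z (u 1 0) ^ 3 - 9 * z (u 0 0) ^ 2 * z (u 1 0) * z (u 2 0)
    - z (u 0 0) ^ 3 * z (u 3 0) + 18 * z nu * z (u 1 0) ^ 2 * z (u 2 0)
    + 12 * z nu * z (u 0 0) * z (u 2 0) ^ 2 + 18 * z nu * z (u 0 0) * z (u 1 0) * z (u 3 0)
    + 3 * z nu * z (u 0 0) ^ 2 * z (u 4 0) - 16 * z nu ^ 2 * z (u 2 0) * z (u 3 0)
    - 9 * z nu ^ 2 * z (u 1 0) * z (u 4 0) - 3 * z nu ^ 2 * z (u 0 0) * z (u 5 0)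
    + z nu ^ 3 * z (u 6 0)

/-- The right-hand side `Q` of the evolution form `u_t + Q = 0` of the differential
approximations. -/
def evol (κ₁ κ₂ : ℝ) (z : Jet) : ℝ :=
  z (u 0 0) * z (u 1 0) - z nu * z (u 2 0)
    + z h ^ 2 / 6 * (z (u 0 0) * z (u 3 0) + 3 * z (u 1 0) * z (u 2 0))
    - z nu * z h ^ 2 / 12 * z (u 4 0)
    + κ₁ * z tau * g₂' z + κ₂ * z tau ^ 2 * g₃' z

theorem Dx_div {F : Jet → ℝ} (hF : JetSmooth F) (a : ℝ) :
    Dx (fun z => F z / a) = fun z => Dx F z / a := by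
  simpa [div_eq_mul_inv] using Dx_mul hF (.const a⁻¹)

theorem Dx_pow {F : Jet → ℝ} (hF : JetSmooth F) (n : ℕ) :
    Dx (fun z => F z ^ (n + 1)) = fun z => (n + 1) * F z ^ n * Dx F z := by
  induction n with
  | zero => simp
  | succ n ih =>
    simp only [pow_succ _ (n + 1)]
    rw [Dx_mul (hF.pow _) hF, ih]
    funext z; push_cast; ring

theorem Dx_sq {F : Jet → ℝ} (hF : JetSmooth F) :
    Dx (fun z => F z ^ 2) = fun z => 2 * F z * Dx F z := by
  rw [Dx_pow hF 1]; funext z; norm_num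

theorem Dx_cube {F : Jet → ℝ} (hF : JetSmooth F) :
    Dx (fun z => F z ^ 3) = fun z => 3 * F z ^ 2 * Dx F z := by
  rw [Dx_pow hF 2]; funext z; norm_num

theorem g₁_eq : g₁ = fun z => -(z (u 0 0) * z (u 1 0)) + z nu * z (u 2 0) := by
  funext z
  unfold g₁
  simp only [Dx_div, Dx_sq, Dx_u, JetSmooth.coord, JetSmooth.pow, Nat.reduceAdd, Nat.reduceLeDiff]
  ring

theorem g₂_eq : g₂ = g₂' := by
  funext z
  unfold g₂ g₂'
  simp (maxDischargeDepth := 30) only [g₁_eq, Dx_mul, Dx_add, Dx_neg, Dx_u, Dx_nu, Dx_const,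
    JetSmooth.coord, JetSmooth.mul, JetSmooth.add, JetSmooth.neg, JetSmooth.const,
    Nat.reduceAdd, Nat.reduceLeDiff]
  ring

theorem Dx_g₂' : Dx g₂' = fun z =>
      2 * z (u 1 0) ^ 3 + 6 * z (u 0 0) * z (u 1 0) * z (u 2 0) + z (u 0 0) ^ 2 * z (u 3 0)
      - 4 * z nu * z (u 2 0) ^ 2 - 6 * z nu * z (u 1 0) * z (u 3 0)
      - 2 * z nu * z (u 0 0) * z (u 4 0) + z nu ^ 2 * z (u 5 0) := by
  unfold g₂'
  simp (maxDischargeDepth := 30) only [Dx_mul, Dx_add, Dx_sub, Dx_sq, Dx_cube, Dx_neg, Dx_u,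
    Dx_nu, Dx_const, JetSmooth.coord, JetSmooth.mul, JetSmooth.add,
    JetSmooth.neg, JetSmooth.sub, JetSmooth.pow, JetSmooth.div_const, JetSmooth.const,
    Nat.reduceAdd, Nat.reduceLeDiff]
  funext z
  ring

theorem Dx_Dx_g₂' : Dx (Dx g₂') = fun z =>
      12 * z (u 1 0) ^ 2 * z (u 2 0) + 6 * z (u 0 0) * z (u 2 0) ^ 2
      + 8 * z (u 0 0) * z (u 1 0) * z (u 3 0) + z (u 0 0) ^ 2 * z (u 4 0)
      - 14 * z nu * z (u 2 0) * z (u 3 0) - 8 * z nu * z (u 1 0) * z (u 4 0)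
      - 2 * z nu * z (u 0 0) * z (u 5 0) + z nu ^ 2 * z (u 6 0) := by
  rw [Dx_g₂']
  simp (maxDischargeDepth := 30) only [Dx_mul, Dx_add, Dx_sub, Dx_sq, Dx_cube, Dx_neg, Dx_u,
    Dx_nu, Dx_const, JetSmooth.coord, JetSmooth.mul, JetSmooth.add,
    JetSmooth.neg, JetSmooth.sub, JetSmooth.pow, JetSmooth.div_const, JetSmooth.const,
    Nat.reduceAdd, Nat.reduceLeDiff]
  funext z
  ring

theorem JetSmooth.g₂' : JetSmooth g₂' := by
  unfold BurgersFDA.g₂'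
  simp (maxDischargeDepth := 30) only [JetSmooth.coord, JetSmooth.mul, JetSmooth.add,
    JetSmooth.neg, JetSmooth.sub, JetSmooth.pow, JetSmooth.div_const, JetSmooth.const]

/-- This expression enters `g₃` with a minus sign and also the Crank–Nicolson correction. -/
theorem Dx_g₁_sq_add : Dx (fun w => g₁ w ^ 2 + w (u 0 0) * g₂ w) = fun z =>
      6 * z (u 0 0) * z (u 1 0) ^ 3 + 9 * z (u 0 0) ^ 2 * z (u 1 0) * z (u 2 0)
      + z (u 0 0) ^ 3 * z (u 3 0) - 6 * z nu * z (u 1 0) ^ 2 * z (u 2 0)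
      - 6 * z nu * z (u 0 0) * z (u 2 0) ^ 2 - 10 * z nu * z (u 0 0) * z (u 1 0) * z (u 3 0)
      - 2 * z nu * z (u 0 0) ^ 2 * z (u 4 0) + 2 * z nu ^ 2 * z (u 2 0) * z (u 3 0)
      + z nu ^ 2 * z (u 1 0) * z (u 4 0) + z nu ^ 2 * z (u 0 0) * z (u 5 0) := by
  rw [g₂_eq, g₁_eq]
  simp (maxDischargeDepth := 30) only [Dx_mul, Dx_add, Dx_sub, Dx_sq, Dx_cube, Dx_neg, Dx_u,
    Dx_nu, Dx_const, Dx_g₂', JetSmooth.g₂',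
    JetSmooth.coord, JetSmooth.mul, JetSmooth.add,
    JetSmooth.neg, JetSmooth.sub, JetSmooth.pow, JetSmooth.div_const, JetSmooth.const,
    Nat.reduceAdd, Nat.reduceLeDiff]
  funext z
  unfold BurgersFDA.g₂'
  ring

theorem g₃_eq : g₃ = g₃' := by
  have h : (fun w => -g₂ w * w (u 0 0) - g₁ w ^ 2) = fun w => -(g₁ w ^ 2 + w (u 0 0) * g₂ w) := by
    funext w; ring
  have hs : JetSmooth fun w => g₁ w ^ 2 + w (u 0 0) * g₂ w := by
    rw [g₁_eq, g₂_eq]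
    simp (maxDischargeDepth := 30) only [JetSmooth.g₂', JetSmooth.coord, JetSmooth.mul,
      JetSmooth.add,
    JetSmooth.neg, JetSmooth.sub, JetSmooth.pow, JetSmooth.div_const, JetSmooth.const]
  funext z
  unfold g₃ g₃'
  rw [h, Dx_neg hs, Dx_g₁_sq_add, g₂_eq, Dx_Dx_g₂']
  ring

theorem commonPart_eq : commonPart = fun z => z (u 0 1) + evol 0 0 z := by
  funext z
  unfold commonPart evol
  simp (maxDischargeDepth := 30) only [Dx_mul, Dx_add, Dx_sub, Dx_sq, Dx_cube, Dx_neg, Dx_u,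
    Dx_nu, Dx_const, JetSmooth.coord, JetSmooth.mul, JetSmooth.add,
    JetSmooth.neg, JetSmooth.sub, JetSmooth.pow, JetSmooth.div_const, JetSmooth.const,
    Nat.reduceAdd, Nat.reduceLeDiff]
  ring

theorem fda_ftcs : fda .ftcs = fun z => z (u 0 1) + evol (1 / 2) 0 z := by
  funext z
  simp only [fda, commonPart_eq, g₂_eq, evol]
  ring

theorem fda_laxWendroff : fda .laxWendroff = fun z => z (u 0 1) + evol 0 (1 / 6) z := by
  funext z
  simp only [fda, commonPart_eq, g₃_eq, evol]
  ring

/-- The extra terms add up to `-g₃/4`, and `1/6 - 1/4 = -1/12`: the scheme differs from Lax–Wendroff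
only in the constant. -/
theorem fda_crankNicolson : fda .crankNicolson = fun z => z (u 0 1) + evol 0 (-1 / 12) z := by
  funext z
  simp only [fda, commonPart_eq, Dx_g₁_sq_add]
  simp only [g₃_eq, g₂_eq, Dx_Dx_g₂', evol, g₃']
  ring

theorem JetSmooth.evol (κ₁ κ₂ : ℝ) : JetSmooth (evol κ₁ κ₂) := by
  unfold BurgersFDA.evol BurgersFDA.g₂' g₃'
  simp (maxDischargeDepth := 30) only [JetSmooth.coord, JetSmooth.mul, JetSmooth.add,
    JetSmooth.neg, JetSmooth.sub, JetSmooth.pow, JetSmooth.div_const, JetSmooth.const]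

/-- The partial derivatives of `evol κ₁ κ₂`. -/
def evolGrad (κ₁ κ₂ : ℝ) : Coord → Jet → ℝ
  | x, _ => 0
  | t, _ => 0
  | h, z =>
      z h / 3 * (z (u 0 0) * z (u 3 0) + 3 * z (u 1 0) * z (u 2 0)) - z nu * z h / 6 * z (u 4 0)
  | tau, z =>
      κ₁ * g₂' z + 2 * κ₂ * z tau * g₃' z
  | nu, z =>
      -z (u 2 0) - z h ^ 2 / 12 * z (u 4 0) + κ₁ * z tau * (-4 * z (u 1 0) * z (u 2 0)
      - 2 * z (u 0 0) * z (u 3 0) + 2 * z nu * z (u 4 0))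
      + κ₂ * z tau ^ 2 * (18 * z (u 1 0) ^ 2 * z (u 2 0) + 12 * z (u 0 0) * z (u 2 0) ^ 2
      + 18 * z (u 0 0) * z (u 1 0) * z (u 3 0) + 3 * z (u 0 0) ^ 2 * z (u 4 0)
      - 32 * z nu * z (u 2 0) * z (u 3 0) - 18 * z nu * z (u 1 0) * z (u 4 0)
      - 6 * z nu * z (u 0 0) * z (u 5 0) + 3 * z nu ^ 2 * z (u 6 0))
  | u 0 0, z =>
      z (u 1 0) + z h ^ 2 / 6 * z (u 3 0) + κ₁ * z tau * (2 * z (u 1 0) ^ 2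
      + 2 * z (u 0 0) * z (u 2 0) - 2 * z nu * z (u 3 0)) + κ₂ * z tau ^ 2 * (-6 * z (u 1 0) ^ 3
      - 18 * z (u 0 0) * z (u 1 0) * z (u 2 0) - 3 * z (u 0 0) ^ 2 * z (u 3 0)
      + 12 * z nu * z (u 2 0) ^ 2 + 18 * z nu * z (u 1 0) * z (u 3 0)
      + 6 * z nu * z (u 0 0) * z (u 4 0) - 3 * z nu ^ 2 * z (u 5 0))
  | u 1 0, z =>
      z (u 0 0) + z h ^ 2 / 2 * z (u 2 0) + κ₁ * z tau * (4 * z (u 0 0) * z (u 1 0)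
      - 4 * z nu * z (u 2 0)) + κ₂ * z tau ^ 2 * (-18 * z (u 0 0) * z (u 1 0) ^ 2
      - 9 * z (u 0 0) ^ 2 * z (u 2 0) + 36 * z nu * z (u 1 0) * z (u 2 0)
      + 18 * z nu * z (u 0 0) * z (u 3 0) - 9 * z nu ^ 2 * z (u 4 0))
  | u 2 0, z =>
      -z nu + z h ^ 2 / 2 * z (u 1 0) + κ₁ * z tau * (z (u 0 0) ^ 2 - 4 * z nu * z (u 1 0))
      + κ₂ * z tau ^ 2 * (-9 * z (u 0 0) ^ 2 * z (u 1 0) + 18 * z nu * z (u 1 0) ^ 2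
      + 24 * z nu * z (u 0 0) * z (u 2 0) - 16 * z nu ^ 2 * z (u 3 0))
  | u 3 0, z =>
      z h ^ 2 / 6 * z (u 0 0) + κ₁ * z tau * (-2 * z nu * z (u 0 0))
      + κ₂ * z tau ^ 2 * (-z (u 0 0) ^ 3 + 18 * z nu * z (u 0 0) * z (u 1 0)
      - 16 * z nu ^ 2 * z (u 2 0))
  | u 4 0, z =>
      -(z nu * z h ^ 2 / 12) + κ₁ * z tau * (z nu ^ 2)
      + κ₂ * z tau ^ 2 * (3 * z nu * z (u 0 0) ^ 2 - 9 * z nu ^ 2 * z (u 1 0))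
  | u 5 0, z =>
      κ₂ * z tau ^ 2 * (-3 * z nu ^ 2 * z (u 0 0))
  | u 6 0, z =>
      κ₂ * z tau ^ 2 * (z nu ^ 3)
  | u (_ + 7) 0, _ => 0
  | u _ (_ + 1), _ => 0

theorem pd_evol (κ₁ κ₂ : ℝ) (c : Coord) : pd c (evol κ₁ κ₂) = evolGrad κ₁ κ₂ c := by
  unfold evol g₂' g₃'
  simp (maxDischargeDepth := 30) only [pd_mul, pd_add, pd_sub, pd_pow, pd_neg, pd_div, pd_const,
    pd_coord, JetSmooth.coord, JetSmooth.mul, JetSmooth.add, JetSmooth.neg, JetSmooth.sub,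
    JetSmooth.pow, JetSmooth.div_const, JetSmooth.const]
  funext z
  rcases c with _ | _ | _ | _ | _ | ⟨_ | _ | _ | _ | _ | _ | _ | i, _ | j⟩ <;>
    simp [evolGrad, g₂', g₃', -mul_eq_mul_left_iff, -mul_eq_mul_right_iff] <;> try ring

theorem pd_x_evol (κ₁ κ₂ : ℝ) : pd x (evol κ₁ κ₂) = fun _ => 0 := pd_evol κ₁ κ₂ x

theorem pd_t_evol (κ₁ κ₂ : ℝ) : pd t (evol κ₁ κ₂) = fun _ => 0 := pd_evol κ₁ κ₂ t

theorem pd_u_succ_evol (κ₁ κ₂ : ℝ) (i j : ℕ) : pd (u i (j + 1)) (evol κ₁ κ₂) = fun _ => 0 := by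
  rw [pd_evol]
  funext z
  simp [evolGrad]

theorem pd_u_evol_of_lt (κ₁ κ₂ : ℝ) {k : ℕ} (hk : 6 < k) :
    pd (u k 0) (evol κ₁ κ₂) = fun _ => 0 := by
  obtain ⟨i, rfl⟩ : ∃ i, k = i + 7 := ⟨k - 7, by omega⟩
  exact pd_evol κ₁ κ₂ _

/-! ### Prolongations -/

section Sigma

variable {V : PointField}

theorem sigma_succ (V : PointField) (i j : ℕ) : sigma V (i + 1) j = fun z => Dx (sigma V i j) z
    - z (u (i + 1) j) * Dx (fun w => V.xi₁ (base w)) z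
    - z (u i (j + 1)) * Dx (fun w => V.xi₂ (base w)) z := by
  funext z; rw [sigma]

theorem sigma_zero_zero (V : PointField) : sigma V 0 0 = fun z => V.eta (base z) := by
  funext z; rw [sigma]

theorem sigma_zero_one (hV : V.IsSmooth) : sigma V 0 1 = fun z =>
    dt V.eta (base z) - z (u 1 0) * dt V.xi₁ (base z)
      + (du V.eta (base z) - z (u 1 0) * du V.xi₁ (base z) - dt V.xi₂ (base z)) * z (u 0 1)
      - z (u 0 1) ^ 2 * du V.xi₂ (base z) := by
  funext z
  rw [sigma, sigma_zero_zero, Dt_base hV.1, Dt_base hV.2.1, Dt_base hV.2.2.1]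
  ring

theorem JetSmooth.sigma (hV : V.IsSmooth) (i : ℕ) : JetSmooth (sigma V i 0) := by
  induction i with
  | zero => rw [sigma_zero_zero]; exact .base _ hV.2.2.1
  | succ i ih =>
    rw [sigma_succ]
    exact (ih.Dx.sub (.mul _ _ (.coord _) (JetSmooth.base _ hV.1).Dx)).sub
      (.mul _ _ (.coord _) (JetSmooth.base _ hV.2.1).Dx)

theorem jetSmooth_sigma_zero_one (hV : V.IsSmooth) : JetSmooth (sigma V 0 1) := by
  have h : sigma V 0 1 = fun z => Dt (sigma V 0 0) z - z (u 1 0) * Dt (fun w => V.xi₁ (base w)) z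
      - z (u 0 1) * Dt (fun w => V.xi₂ (base w)) z := by
    funext z; simp only [sigma]
  rw [h]
  exact ((JetSmooth.sigma hV 0).Dt.sub (.mul _ _ (.coord _) (JetSmooth.base _ hV.1).Dt)).sub
    (.mul _ _ (.coord _) (JetSmooth.base _ hV.2.1).Dt)

theorem pd_Dx_base {f : ℝ × ℝ × ℝ → ℝ} (hf : ContDiff ℝ ∞ f) {i j : ℕ} (h₀ : (i, j) ≠ (0, 0))
    (h₁ : (i, j) ≠ (1, 0)) : pd (u i j) (Dx fun z => f (base z)) = fun _ => 0 := by
  have hc : u 1 0 ≠ u i j := by simpa [eq_comm] using h₁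
  rw [Dx_base hf, pd_add (.base _ (contDiff_dx hf)) (.mul _ _ (.coord _) (.base _ (contDiff_du
    hf))),
    pd_mul (.coord _) (.base _ (contDiff_du hf)), pd_base_u_of_ne (contDiff_dx hf) h₀,
    pd_base_u_of_ne (contDiff_du hf) h₀, pd_coord]
  simp [hc]

theorem pd_Dx_base_one {f : ℝ × ℝ × ℝ → ℝ} (hf : ContDiff ℝ ∞ f) :
    pd (u 1 0) (Dx fun z => f (base z)) = fun z => du f (base z) := by
  rw [Dx_base hf, pd_add (.base _ (contDiff_dx hf)) (.mul _ _ (.coord _) (.base _ (contDiff_du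
    hf))),
    pd_mul (.coord _) (.base _ (contDiff_du hf)), pd_base_u_of_ne (contDiff_dx hf) (by simp),
    pd_base_u_of_ne (contDiff_du hf) (by simp), pd_coord]
  simp

theorem pd_sigma_succ (hV : V.IsSmooth) (i : ℕ) (c : Coord) :
    pd c (sigma V (i + 1) 0) = fun z => pd c (Dx (sigma V i 0)) z
      - ((if u (i + 1) 0 = c then 1 else 0) * Dx (fun w => V.xi₁ (base w)) z
        + z (u (i + 1) 0) * pd c (Dx fun w => V.xi₁ (base w)) z)
      - ((if u i 1 = c then 1 else 0) * Dx (fun w => V.xi₂ (base w)) z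
        + z (u i 1) * pd c (Dx fun w => V.xi₂ (base w)) z) := by
  have h₁ := (JetSmooth.base _ hV.1).Dx
  have h₂ := (JetSmooth.base _ hV.2.1).Dx
  rw [sigma_succ, pd_sub ((JetSmooth.sigma hV i).Dx.sub (.mul _ _ (.coord _) h₁))
    (.mul _ _ (.coord _) h₂), pd_sub (JetSmooth.sigma hV i).Dx (.mul _ _ (.coord _) h₁),
    pd_mul (.coord _) h₁, pd_mul (.coord _) h₂, pd_coord, pd_coord]

/-- The coefficient of `∂/∂u_k` involves only derivatives of order at most `k`. -/
theorem pd_sigma_of_lt (hV : V.IsSmooth) {k i j : ℕ} (h : k < i + j) :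
    pd (u i j) (sigma V k 0) = fun _ => 0 := by
  induction k generalizing i j with
  | zero =>
    rw [sigma_zero_zero]
    exact pd_base_u_of_ne hV.2.2.1 (by simp; omega)
  | succ k ih =>
    have hD : pd (u i j) (Dx (sigma V k 0)) = fun _ => 0 := by
      cases i with
      | zero => rw [pd_u_zero_Dx (JetSmooth.sigma hV k), ih (by omega), Dx_const]
      | succ i =>
        rw [pd_u_Dx (JetSmooth.sigma hV k) (.inr (ih (by omega))), ih (i := i + 1) (by omega),
          ih (by omega), Dx_const]
        simp
    have h₁ : ¬ (k + 1 = i ∧ 0 = j) := by omega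
    have h₂ : ¬ (k = i ∧ 1 = j) := by omega
    rw [pd_sigma_succ hV, hD, pd_Dx_base hV.1 (by simp; omega) (by simp; omega),
      pd_Dx_base hV.2.1 (by simp; omega) (by simp; omega)]
    simp [h₁, h₂]

/-- Each step of the recursion contributes one `-D_x ξ₂` through its last term, while the commutator
with `D_x` carries over the coefficient from the previous step. -/
theorem pd_mixed_sigma (hV : V.IsSmooth) {k : ℕ} (hk : k ≤ 5) :
    pd (u k 1) (sigma V (k + 1) 0)
      = fun z => -((k + 1 : ℕ) : ℝ) * Dx (fun w => V.xi₂ (base w)) z := by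
  induction k with
  | zero =>
    rw [pd_sigma_succ hV, pd_u_zero_Dx (JetSmooth.sigma hV 0), pd_sigma_of_lt hV (by simp),
      Dx_const, pd_Dx_base hV.1 (by simp) (by simp), pd_Dx_base hV.2.1 (by simp) (by simp)]
    simp
  | succ k ih =>
    rw [pd_sigma_succ hV, pd_u_Dx (JetSmooth.sigma hV _) (.inl (by omega)),
      pd_sigma_of_lt hV (k := k + 1) (i := k + 1) (by simp), Dx_const, ih (by omega),
      pd_Dx_base hV.1 (by simp) (by simp), pd_Dx_base hV.2.1 (by simp) (by simp)]
    funext z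
    simp
    ring

/-- The term with `D_x ξ₂` is the only source of t-derivatives in the recursion. -/
theorem pd_u_one_sigma (hV : V.IsSmooth) (h₂ : (Dx fun w => V.xi₂ (base w)) = fun _ => 0) (k : ℕ) :
    pd (u 0 1) (sigma V k 0) = fun _ => 0 := by
  induction k with
  | zero => exact pd_sigma_of_lt hV (by simp)
  | succ k ih =>
    rw [pd_sigma_succ hV, pd_u_zero_Dx (JetSmooth.sigma hV k), ih, Dx_const,
      pd_Dx_base hV.1 (by simp) (by simp), h₂]
    simp

/-- One `D_x ξ₁` is lost per step. The last term arises only in the first step, where `u_x`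
multiplies `D_x ξ₁`, which itself contains `u_x`. -/
theorem pd_top_sigma (hV : V.IsSmooth) (h₂ : (Dx fun w => V.xi₂ (base w)) = fun _ => 0) {k : ℕ}
    (hk : k ≤ 5) : pd (u (k + 1) 0) (sigma V (k + 1) 0) = fun z => du V.eta (base z)
      - ((k + 1 : ℕ) : ℝ) * Dx (fun w => V.xi₁ (base w)) z - z (u 1 0) * du V.xi₁ (base z) := by
  induction k with
  | zero =>
    rw [pd_sigma_succ hV, pd_u_Dx (JetSmooth.sigma hV 0) (.inl (by simp)),
      pd_sigma_of_lt hV (by simp), Dx_const, h₂, sigma_zero_zero, pd_base_u hV.2.2.1,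
      pd_Dx_base_one hV.1]
    funext z
    simp
    ring
  | succ k ih =>
    rw [pd_sigma_succ hV, pd_u_Dx (JetSmooth.sigma hV _) (.inl (by omega)),
      pd_sigma_of_lt hV (by simp), Dx_const, ih (by omega), h₂,
      pd_Dx_base hV.1 (by simp) (by simp)]
    funext z
    simp
    ring

theorem Dx_base_of_du_eq_zero {f : ℝ × ℝ × ℝ → ℝ} (hf : ContDiff ℝ ∞ f)
    (h : du f = fun _ => 0) : Dx (fun z => f (base z)) = fun z => dx f (base z) := by
  rw [Dx_base hf, h]; simp

theorem du_dx_eq_zero {f : ℝ × ℝ × ℝ → ℝ} (hf : ContDiff ℝ ∞ f) (h : du f = fun _ => 0) :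
    du (dx f) = fun _ => 0 := by
  rw [du_dx hf, h, dx_zero]

/-- Step `j` of the recursion adds `D_x` of the previous top coefficient `η_u - j ξ₁_x`; summing
over `j ≤ k` gives the factors `k + 1` and `(k + 1) k / 2`. -/
theorem pd_next_sigma (hV : V.IsSmooth) (h₂ : (Dx fun w => V.xi₂ (base w)) = fun _ => 0)
    (h₁ : du V.xi₁ = fun _ => 0) {k : ℕ} (hk : k ≤ 5) :
    pd (u k 0) (sigma V (k + 1) 0) = fun z =>
      (k + 1) * (dx (du V.eta) (base z) + z (u 1 0) * du (du V.eta) (base z))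
        - (k + 1) * k / 2 * dx (dx V.xi₁) (base z) := by
  have hd := du_dx_eq_zero hV.1 h₁
  induction k with
  | zero =>
    rw [pd_sigma_succ hV, pd_u_zero_Dx (JetSmooth.sigma hV 0), sigma_zero_zero,
      pd_base_u hV.2.2.1, Dx_base (contDiff_du hV.2.2.1), Dx_base_of_du_eq_zero hV.1 h₁,
      pd_base_u (contDiff_dx hV.1), hd, h₂]
    funext z
    simp
  | succ k ih =>
    have ht : pd (u (k + 1) 0) (sigma V (k + 1) 0) = fun z => du V.eta (base z)
        - ((k + 1 : ℕ) : ℝ) * dx V.xi₁ (base z) := by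
      rw [pd_top_sigma hV h₂ (by omega), h₁, Dx_base_of_du_eq_zero hV.1 h₁]
      simp
    rw [pd_sigma_succ hV, pd_u_Dx (JetSmooth.sigma hV _) (.inl (by omega)), ih (by omega), ht,
      Dx_sub (.base _ (contDiff_du hV.2.2.1)) (.mul _ _ (.const _) (.base _ (contDiff_dx hV.1))),
      Dx_mul (.const _) (.base _ (contDiff_dx hV.1)), Dx_const,
      Dx_base (contDiff_du hV.2.2.1), Dx_base_of_du_eq_zero (contDiff_dx hV.1) hd,
      Dx_base_of_du_eq_zero hV.1 h₁, pd_base_u_of_ne (contDiff_dx hV.1) (by simp), h₂]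
    funext z
    simp
    ring

end Sigma

/-! ### The determining equations of an evolution equation `u_t + Q = 0` -/

/-- The part of a prolongation that comes from `h`, `τ`, `ν`, with coefficients frozen at `p`. -/
def parPart (V : PointField) (p : Point) (Q : Jet → ℝ) (z : Jet) : ℝ :=
  V.zeta₁ p * pd h Q z + V.zeta₂ p * pd tau Q z + V.theta p * pd nu Q z

/-- The part of a prolongation that comes from the derivatives in `x`. -/
def spatialPart (V : PointField) (Q : Jet → ℝ) (z : Jet) : ℝ :=
  ∑ k ∈ Finset.range 7, sigma V k 0 z * pd (u k 0) Q z

theorem jetSum_of_succ {n : ℕ} {f : ℕ → ℕ → ℝ} (h : ∀ i j, f i (j + 1) = 0) :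
    jetSum n f = ∑ i ∈ Finset.range (n + 1), f i 0 := by
  refine Finset.sum_congr rfl fun i hi => Finset.sum_eq_single 0 ?_ ?_
  · intro j _ hj
    obtain ⟨j, rfl⟩ := Nat.exists_eq_succ_of_ne_zero hj
    exact h i j
  · intro h0; simp at h0 hi; omega

/-- The range of the sum in `spatialPart` does not depend on `n`, so prolongations of different
orders become comparable. -/
theorem prolong_evolution (V : PointField) {n : ℕ} (hn : 1 ≤ n) (hn' : n ≤ 6) {Q : Jet → ℝ}
    (hQ : JetSmooth Q) (hx : pd x Q = fun _ => 0) (ht : pd t Q = fun _ => 0)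
    (hu : ∀ i j, pd (u i (j + 1)) Q = fun _ => 0) (hk : ∀ k, n < k → pd (u k 0) Q = fun _ => 0)
    (z : Jet) : prolong n V (fun z => z (u 0 1) + Q z) z
      = parPart V (base z, par z) Q z + spatialPart V Q z + sigma V 0 1 z := by
  have hs : spatialPart V Q z = ∑ k ∈ Finset.range (n + 1), sigma V k 0 z * pd (u k 0) Q z := by
    refine (Finset.sum_subset (fun k => by simp; omega) fun k _ hk' => ?_).symm
    rw [hk k (by simpa using hk')]; simp
  unfold prolong
  simp only [pd_add (.coord _) hQ, pd_coord, hx, ht, mul_add, jetSum_add]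
  rw [jetSum_of_succ (f := fun i j => sigma V i j z * pd (u i j) Q z) (by simp [hu]),
    jetSum_single (i := 0) (j := 1), hs, parPart]
  · simp; ring
  · intro k l hkl; simp; grind
  · left; omega

theorem JetSmooth.parPart (V : PointField) (p : Point) {Q : Jet → ℝ} (hQ : JetSmooth Q) :
    JetSmooth (parPart V p Q) :=
  .add _ _ (.add _ _ (.mul _ _ (.const _) (hQ.pd _)) (.mul _ _ (.const _) (hQ.pd _)))
    (.mul _ _ (.const _) (hQ.pd _))

theorem JetSmooth.spatialPart {V : PointField} (hV : V.IsSmooth) {Q : Jet → ℝ}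
    (hQ : JetSmooth Q) : JetSmooth (spatialPart V Q) :=
  .sum _ fun k _ => .mul _ _ (.sigma hV k) (hQ.pd _)

/-- With frozen coefficients, `ζ₁`, `ζ₂` and `θ` are never differentiated. They are smooth only on
`phaseSpace`, which has the boundary `ν = 0`. -/
theorem pd_parPart (V : PointField) (p : Point) {Q : Jet → ℝ} (hQ : JetSmooth Q) (c : Coord) :
    pd c (parPart V p Q) = parPart V p (pd c Q) := by
  have H : ∀ (a : ℝ) (d : Coord), JetSmooth fun z => a * pd d Q z :=
    fun a d => .mul _ _ (.const _) (hQ.pd _)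
  unfold parPart
  rw [pd_add (.add _ _ (H _ _) (H _ _)) (H _ _), pd_add (H _ _) (H _ _)]
  simp only [pd_mul (.const _) (hQ.pd _), pd_const, pd_comm hQ c]
  simp

theorem pd_spatialPart {V : PointField} (hV : V.IsSmooth) {Q : Jet → ℝ} (hQ : JetSmooth Q)
    (c : Coord) : pd c (spatialPart V Q) = fun z => (∑ k ∈ Finset.range 7,
      pd c (sigma V k 0) z * pd (u k 0) Q z) + spatialPart V (pd c Q) z := by
  unfold spatialPart
  rw [pd_sum _ fun k => .mul _ _ (.sigma hV k) (hQ.pd _)]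
  funext z
  rw [← Finset.sum_add_distrib]
  refine Finset.sum_congr rfl fun k _ => ?_
  rw [pd_mul (.sigma hV k) (hQ.pd _), pd_comm hQ c]

theorem parPart_zero (V : PointField) (p : Point) : parPart V p (fun _ => 0) = fun _ => 0 := by
  funext z; simp [parPart]

theorem spatialPart_zero (V : PointField) : spatialPart V (fun _ => 0) = fun _ => 0 := by
  funext z; simp [spatialPart]

/-! ### Consequences of the determining equations -/

/-- The left-hand side of the evolution form of the differential approximations. -/
abbrev evolEq (κ₁ κ₂ : ℝ) (z : Jet) : ℝ := z (u 0 1) + evol κ₁ κ₂ z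

/-- The coefficients of the two highest derivatives `u_{m+1}` and `u_m` in `evol κ₁ κ₂` are
`a` and `b u`, where `a` and `b` are linearly independent functions of the parameters. -/
structure HasLeading (κ₁ κ₂ : ℝ) (m : ℕ) (a b : ℝ × ℝ × ℝ → ℝ) : Prop where
  -- The bounds keep `u_m` and `u_{m+1}` apart from `u_x`, which the determining equations contain
  -- also outside `Q`, and within the truncated sums.
  two_lt : 2 < m
  lt_six : m < 6
  higher : ∀ k, m + 1 < k → pd (u k 0) (evol κ₁ κ₂) = fun _ => 0
  top : pd (u (m + 1) 0) (evol κ₁ κ₂) = fun z => a (par z)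
  next : pd (u m 0) (evol κ₁ κ₂) = fun z => b (par z) * z (u 0 0)
  indep : ∀ y w : ℝ, (∀ q ∈ params, y * b q + w * a q = 0) → y = 0 ∧ w = 0

/-- The jet with the given values of `(x, t, u)`, `(h, τ, ν)` and `u_k`, `k ≥ 1`, whose
coordinates `u_{ij}` with `j ≥ 1` vanish except for `u_t`. -/
def mkJet (p q : ℝ × ℝ × ℝ) (w : ℕ → ℝ) (v : ℝ) : Jet
  | x => p.1
  | t => p.2.1
  | h => q.1
  | tau => q.2.1
  | nu => q.2.2
  | u 0 0 => p.2.2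
  | u (i + 1) 0 => w i
  | u 0 1 => v
  | u _ _ => 0

section MkJet
variable (p q : ℝ × ℝ × ℝ) (w : ℕ → ℝ) (v : ℝ)

@[simp] theorem mkJet_h : mkJet p q w v h = q.1 := rfl
@[simp] theorem mkJet_tau : mkJet p q w v tau = q.2.1 := rfl
@[simp] theorem mkJet_nu : mkJet p q w v nu = q.2.2 := rfl
@[simp] theorem mkJet_u : mkJet p q w v (u 0 0) = p.2.2 := rfl
@[simp] theorem mkJet_u_one : mkJet p q w v (u 1 0) = w 0 := rfl
@[simp] theorem mkJet_u_two : mkJet p q w v (u 2 0) = w 1 := rfl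
@[simp] theorem mkJet_u_three : mkJet p q w v (u 3 0) = w 2 := rfl
@[simp] theorem mkJet_u_four : mkJet p q w v (u 4 0) = w 3 := rfl
@[simp] theorem mkJet_u_five : mkJet p q w v (u 5 0) = w 4 := rfl
@[simp] theorem mkJet_u_six : mkJet p q w v (u 6 0) = w 5 := rfl
@[simp] theorem base_mkJet : base (mkJet p q w v) = p := rfl
@[simp] theorem par_mkJet : par (mkJet p q w v) = q := rfl

end MkJet

theorem base_update_of_ne (z : Jet) {i j : ℕ} (hij : (i, j) ≠ (0, 0)) (s : ℝ) :
    base (Function.update z (u i j) s) = base z := by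
  have : u 0 0 ≠ u i j := by simpa [eq_comm] using hij
  simp [base, this]

theorem par_update (z : Jet) (i j : ℕ) (s : ℝ) : par (Function.update z (u i j) s) = par z := by
  simp [par]

theorem pd_par_congr (a : ℝ × ℝ × ℝ → ℝ) (c : Coord) (hc : c = h ∨ c = tau ∨ c = nu)
    {z z' : Jet} (hz : par z = par z') :
    pd c (fun w => a (par w)) z = pd c (fun w => a (par w)) z' := by
  simp only [par, Prod.mk.injEq] at hz
  obtain ⟨h₁, h₂, h₃⟩ := hz
  rcases hc with rfl | rfl | rfl <;> simp [pd, par, h₁, h₂, h₃]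

/-- The unknown `ζ₁`, `ζ₂`, `θ` thus contribute equally at jets with the same parameters, and cancel
when two such equations are subtracted. -/
theorem parPart_par_congr (V : PointField) (p : Point) (a : ℝ × ℝ × ℝ → ℝ) {z z' : Jet}
    (hz : par z = par z') :
    parPart V p (fun w => a (par w)) z = parPart V p (fun w => a (par w)) z' := by
  simp [parPart, pd_par_congr a _ _ hz]

section Determining

variable {V : PointField} {κ₁ κ₂ : ℝ}

theorem prolong_evolEq (V : PointField) (κ₁ κ₂ : ℝ) (z : Jet) :
    prolong 6 V (evolEq κ₁ κ₂) z = parPart V (base z, par z) (evol κ₁ κ₂) z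
      + spatialPart V (evol κ₁ κ₂) z + sigma V 0 1 z := by
  refine prolong_evolution V (by simp) le_rfl (.evol _ _) (pd_x_evol _ _) (pd_t_evol _ _)
    (pd_u_succ_evol _ _) (fun k hk => pd_u_evol_of_lt _ _ hk) z

theorem IsSymmetry.prolong_eq_zero (hS : IsSymmetry 6 (evolEq κ₁ κ₂) V) {z : Jet} (hz : par z ∈
    params)
    (hu : z (u 0 1) = -evol κ₁ κ₂ z) : parPart V (base z, par z) (evol κ₁ κ₂) z
      + spatialPart V (evol κ₁ κ₂) z + sigma V 0 1 z = 0 := by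
  rw [← prolong_evolEq]
  exact hS.2 z hz (by simp [evolEq, hu])

theorem evol_update (κ₁ κ₂ : ℝ) (z : Jet) (i j : ℕ) (s : ℝ) :
    evol κ₁ κ₂ (Function.update z (u i (j + 1)) s) = evol κ₁ κ₂ z :=
  (JetSmooth.evol κ₁ κ₂).update_eq (pd_u_succ_evol κ₁ κ₂ i j) z s

theorem pd_eq_zero_of_forall_update {F : Jet → ℝ} {c : Coord} {z : Jet}
    (hF : ∀ s, F (Function.update z c s) = 0) : pd c F z = 0 := by
  simp [pd, hF]

theorem pd_sigma_zero_one (hV : V.IsSmooth) {i j : ℕ} (hij : 1 < i + j) :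
    pd (u i j) (sigma V 0 1) = fun _ => 0 := by
  have h₁ : ¬ (1 = i ∧ 0 = j) := by omega
  have h₂ : ¬ (0 = i ∧ 1 = j) := by omega
  have h₀ : (i, j) ≠ (0, 0) := by simp; omega
  rw [sigma_zero_one hV]
  funext z
  simp [pd, base_update_of_ne _ h₀, h₁, h₂]

/-- As `Q` does not involve `u_t`, the value `u_t = -Q` can be prescribed without circularity. -/
theorem evol_mkJet (κ₁ κ₂ : ℝ) (p q : ℝ × ℝ × ℝ) (w : ℕ → ℝ) (v : ℝ) :
    evol κ₁ κ₂ (mkJet p q w v) = evol κ₁ κ₂ (mkJet p q w 0) := by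
  simp [evol, g₂', g₃']

/-- The coefficient `ξ₂` depends on `t` only. -/
theorem Dx_xi₂_eq_zero {m : ℕ} {a b : ℝ × ℝ × ℝ → ℝ} (hL : HasLeading κ₁ κ₂ m a b)
    (hS : IsSymmetry 6 (evolEq κ₁ κ₂) V) : (Dx fun w => V.xi₂ (base w)) = fun _ => 0 := by
  have hV := hS.1
  have hm := hL.two_lt
  have hm' := hL.lt_six
  obtain ⟨q, hq, ha⟩ : ∃ q ∈ params, a q ≠ 0 := by
    by_contra! hc
    exact one_ne_zero (hL.indep 0 1 fun q hq => by simp [hc q hq]).2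
  have key : ∀ z : Jet, par z = q → z (u 0 1) = -evol κ₁ κ₂ z →
      Dx (fun w => V.xi₂ (base w)) z = 0 := by
    intro z hz hzu
    -- Varying `u_{m,1}` does not leave the equation manifold, because neither `u_t` nor `Q`
    -- changes; the coefficients at the base point stay fixed too.
    have h0 := pd_eq_zero_of_forall_update (c := u m 1) (z := z)
      (F := fun w => parPart V (base z, par z) (evol κ₁ κ₂) w + spatialPart V (evol κ₁ κ₂) w
        + sigma V 0 1 w) fun s => by
        have hne : u 0 1 ≠ u m 1 := by simp; omega
        have := hS.prolong_eq_zero (z := Function.update z (u m 1) s)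
          (by rw [par_update, hz]; exact hq) (by simp [hne, hzu, evol_update])
        rwa [base_update_of_ne _ (by simp), par_update] at this
    have hp := JetSmooth.parPart V (base z, par z) (.evol κ₁ κ₂)
    have hsp := JetSmooth.spatialPart hV (.evol κ₁ κ₂)
    rw [pd_add (.add _ _ hp hsp) (jetSmooth_sigma_zero_one hV), pd_add hp hsp,
      pd_parPart _ _ (.evol _ _), pd_spatialPart hV (.evol _ _), pd_u_succ_evol _ _ m 0,
      parPart_zero, spatialPart_zero] at h0
    beta_reduce at h0
    -- Lower prolongation coefficients do not reach `u_{m,1}`, and `Q` contains no derivative of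
    -- order above `m + 1`.
    rw [Finset.sum_eq_single (m + 1), pd_mixed_sigma hV (by omega),
      hL.top] at h0
    · rw [pd_sigma_zero_one hV (by omega)] at h0
      have hm0 : ((m + 1 : ℕ) : ℝ) ≠ 0 := by positivity
      simpa [ha, hm0, hz, -Nat.cast_add] using h0
    · intro k hk hkm
      rcases lt_or_gt_of_ne hkm with hlt | hgt
      · rw [pd_sigma_of_lt hV (by omega)]; simp
      · rw [hL.higher k hgt]; simp
    · intro hmem; simp at hmem; omega
  funext z
  -- `D_x ξ₂` depends only on the base point and `u_x`, so any jet may be replaced by one on the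
  -- equation with parameters `q`.
  have := key (mkJet (base z) q (fun _ => z (u 1 0))
    (-evol κ₁ κ₂ (mkJet (base z) q (fun _ => z (u 1 0)) 0))) rfl (by rw [evol_mkJet]; rfl)
  rw [Dx_base hV.2.1] at this ⊢
  simpa using this

theorem dx_xi₂_eq_zero (hV : V.IsSmooth)
    (h₂ : (Dx fun w => V.xi₂ (base w)) = fun _ => 0) :
    dx V.xi₂ = (fun _ => 0) ∧ du V.xi₂ = fun _ => 0 := by
  have key : ∀ p s, dx V.xi₂ p + s * du V.xi₂ p = 0 := fun p s => by
    -- The second `p` is a dummy value of the parameters; only the dependence on `u_x = s` matters.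
    have := congrFun h₂ (mkJet p p (fun _ => s) 0)
    rw [Dx_base hV.2.1] at this
    simpa using this
  have hx : ∀ p, dx V.xi₂ p = 0 := fun p => by simpa using key p 0
  exact ⟨funext hx, funext fun p => by simpa [hx] using key p 1⟩

/-- The determining equations with `u_t` eliminated. -/
def detEq (V : PointField) (p : Point) (Q : Jet → ℝ) (z : Jet) : ℝ :=
  parPart V p Q z + spatialPart V Q z + (dt V.eta (base z) - z (u 1 0) * dt V.xi₁ (base z)
    - (du V.eta (base z) - z (u 1 0) * du V.xi₁ (base z) - dt V.xi₂ (base z)) * Q z)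

/-- Any jet is moved onto the equation by resetting `u_t` to `-Q`. Once `D_x ξ₂ = 0`, only `sigma V
0 1` feels this change, so an identity in all jets with admissible parameters results. -/
theorem IsSymmetry.detEq_eq_zero (hS : IsSymmetry 6 (evolEq κ₁ κ₂) V)
    (h₂ : (Dx fun w => V.xi₂ (base w)) = fun _ => 0) {z : Jet} (hz : par z ∈ params) :
    detEq V (base z, par z) (evol κ₁ κ₂) z = 0 := by
  have hV := hS.1
  have hE := JetSmooth.evol κ₁ κ₂
  have hpd := pd_u_succ_evol κ₁ κ₂ 0 0
  have hup : ∀ F, JetSmooth F → pd (u 0 1) F = (fun _ => 0) → ∀ s,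
      F (Function.update z (u 0 1) s) = F z := fun F hF h s => hF.update_eq h z s
  have h := hS.prolong_eq_zero (z := Function.update z (u 0 1) (-evol κ₁ κ₂ z))
    (by rwa [par_update]) (by simp [evol_update])
  rw [base_update_of_ne _ (by simp), par_update,
    hup _ (.parPart V _ hE) (by rw [pd_parPart _ _ hE, hpd, parPart_zero]),
    hup _ (.spatialPart hV hE), sigma_zero_one hV, (dx_xi₂_eq_zero hV h₂).2] at h
  · simp only [detEq]
    rw [← h]
    simp [base_update_of_ne]
    ring
  · rw [pd_spatialPart hV hE, hpd, spatialPart_zero]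
    simp [pd_u_one_sigma hV h₂]

theorem JetSmooth.detTail (hV : V.IsSmooth) {Q : Jet → ℝ} (hQ : JetSmooth Q) :
    JetSmooth fun z => dt V.eta (BurgersFDA.base z) - z (u 1 0) * dt V.xi₁ (BurgersFDA.base z)
    - (du V.eta (BurgersFDA.base z) - z (u 1 0) * du V.xi₁ (BurgersFDA.base z)
      - dt V.xi₂ (BurgersFDA.base z)) * Q z := by
  have h := fun f hf => JetSmooth.base (dt f) (contDiff_dt hf)
  have h' := fun f hf => JetSmooth.base (du f) (contDiff_du hf)
  exact ((h _ hV.2.2.1).sub (.mul _ _ (.coord _) (h _ hV.1))).sub (.mul _ _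
    (((h' _ hV.2.2.1).sub (.mul _ _ (.coord _) (h' _ hV.1))).sub (h _ hV.2.1)) hQ)

/-- The derivative of the determining equations in `u_k`, `k ≥ 2`. -/
theorem IsSymmetry.pd_detEq (hS : IsSymmetry 6 (evolEq κ₁ κ₂) V)
    (h₂ : (Dx fun w => V.xi₂ (base w)) = fun _ => 0) {z : Jet} (hz : par z ∈ params) {k : ℕ}
    (hk : 1 < k) : parPart V (base z, par z) (pd (u k 0) (evol κ₁ κ₂)) z
      + ((∑ l ∈ Finset.range 7, pd (u k 0) (sigma V l 0) z * pd (u l 0) (evol κ₁ κ₂) z)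
        + spatialPart V (pd (u k 0) (evol κ₁ κ₂)) z)
      - (du V.eta (base z) - z (u 1 0) * du V.xi₁ (base z) - dt V.xi₂ (base z))
        * pd (u k 0) (evol κ₁ κ₂) z = 0 := by
  have hV := hS.1
  have hE := JetSmooth.evol κ₁ κ₂
  have hb : ∀ s, base (Function.update z (u k 0) s) = base z :=
    base_update_of_ne z (by simp; omega)
  have h := pd_eq_zero_of_forall_update (c := u k 0) (z := z)
    (F := detEq V (base z, par z) (evol κ₁ κ₂)) fun s => by
      have := hS.detEq_eq_zero h₂ (z := Function.update z (u k 0) s) (by rwa [par_update])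
      rwa [hb, par_update] at this
  have hne : 1 ≠ k := by omega
  have ht : pd (u k 0) (fun z => dt V.eta (base z) - z (u 1 0) * dt V.xi₁ (base z)
      - (du V.eta (base z) - z (u 1 0) * du V.xi₁ (base z) - dt V.xi₂ (base z)) * evol κ₁ κ₂ z) z
      = - ((du V.eta (base z) - z (u 1 0) * du V.xi₁ (base z) - dt V.xi₂ (base z))
        * pd (u k 0) (evol κ₁ κ₂) z) := by
    apply pd_eq_of_hasDerivAt
    simpa [hb, hne] using ((hE.hasDerivAt (u k 0) z).const_mul (du V.eta (base z)
      - z (u 1 0) * du V.xi₁ (base z) - dt V.xi₂ (base z))).const_sub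
        (dt V.eta (base z) - z (u 1 0) * dt V.xi₁ (base z))
  have hp := JetSmooth.parPart V (base z, par z) hE
  have hsp := JetSmooth.spatialPart hV hE
  unfold detEq at h
  rw [pd_add (.add _ _ hp hsp) (.detTail hV hE), pd_add hp hsp, pd_parPart _ _ hE,
    pd_spatialPart hV hE] at h
  beta_reduce at h
  rw [ht] at h
  linarith

/-- The coefficient `ξ₁` does not depend on `u`. -/
theorem du_xi₁_eq_zero {m : ℕ} {a b : ℝ × ℝ × ℝ → ℝ} (hL : HasLeading κ₁ κ₂ m a b)
    (hS : IsSymmetry 6 (evolEq κ₁ κ₂) V) : du V.xi₁ = fun _ => 0 := by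
  have hV := hS.1
  have hm := hL.two_lt
  have hm' := hL.lt_six
  have h₂ := Dx_xi₂_eq_zero hL hS
  obtain ⟨q, hq, ha⟩ : ∃ q ∈ params, a q ≠ 0 := by
    by_contra! hc
    exact one_ne_zero (hL.indep 0 1 fun q hq => by simp [hc q hq]).2
  funext p
  -- This is the coefficient of `u_{m+1}` at `u_x = s`. It is affine in `s` with slope `-(m + 1) a
  -- ξ₁_u`, so comparing `s = 0` and `s = 1` suffices.
  have key : ∀ s, parPart V (p, q) (fun z => a (par z)) (mkJet p q (fun _ => 0) 0)
      + (du V.eta p - (m + 1) * (dx V.xi₁ p + s * du V.xi₁ p) - s * du V.xi₁ p) * a q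
      - (du V.eta p - s * du V.xi₁ p - dt V.xi₂ p) * a q = 0 := by
    intro s
    have h := hS.pd_detEq h₂ (z := mkJet p q (fun _ => s) 0) hq (k := m + 1) (by omega)
    rw [Finset.sum_eq_single (m + 1), pd_top_sigma hV h₂ (by omega), hL.top, Dx_base hV.1,
      parPart_par_congr _ _ a (z := mkJet p q (fun _ => s) 0)
        (z' := mkJet p q (fun _ => 0) 0) rfl] at h
    · have hs0 : spatialPart V (fun z => a (par z)) (mkJet p q (fun _ => s) 0) = 0 := by
        simp [spatialPart, pd, par_update]
      rw [hs0] at h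
      simpa using h
    · intro k hk hkm
      rcases lt_or_gt_of_ne hkm with hlt | hgt
      · rw [pd_sigma_of_lt hV (by omega)]; simp
      · rw [hL.higher k hgt]; simp
    · intro hmem; simp at hmem; omega
  have h0 := key 0
  have h1 := key 1
  have : ((m : ℝ) + 1) * a q * du V.xi₁ p = 0 := by linear_combination h0 - h1
  have hm0 : (m : ℝ) + 1 ≠ 0 := by positivity
  simpa [ha, hm0] using this

/-- The coefficient `η` is affine in `u` and vanishes for `u = 0`. -/
theorem eta_relations {m : ℕ} {a b : ℝ × ℝ × ℝ → ℝ} (hL : HasLeading κ₁ κ₂ m a b)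
    (hS : IsSymmetry 6 (evolEq κ₁ κ₂) V) : (du (du V.eta) = fun _ => 0) ∧
      ∀ x t, V.eta (x, t, 0) = 0 ∧
        2 * dx (du V.eta) (x, t, 0) = m * dx (dx V.xi₁) (x, t, 0) := by
  have hV := hS.1
  have hm := hL.two_lt
  have hm' := hL.lt_six
  have h₂ := Dx_xi₂_eq_zero hL hS
  have h₁ := du_xi₁_eq_zero hL hS
  -- This is the coefficient of `u_m` at `u_x = s`. In the sum only the orders `m` and `m + 1`
  -- survive; the slope in `s` is `(m + 1) a η_uu`.
  have key : ∀ p q, q ∈ params → ∀ s,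
      p.2.2 * parPart V (p, q) (fun z => b (par z)) (mkJet p q (fun _ => 0) 0)
      + ((du V.eta p - m * dx V.xi₁ p) * (b q * p.2.2)
        + ((m + 1) * (dx (du V.eta) p + s * du (du V.eta) p)
          - (m + 1) * m / 2 * dx (dx V.xi₁) p) * a q
        + V.eta p * b q) - (du V.eta p - dt V.xi₂ p) * (b q * p.2.2) = 0 := by
    intro p q hq s
    have h := hS.pd_detEq h₂ (z := mkJet p q (fun _ => s) 0) hq (k := m) (by omega)
    obtain ⟨k, rfl⟩ : ∃ k, m = k + 1 := ⟨m - 1, by omega⟩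
    have hs0 : spatialPart V (fun z => b (par z) * z (u 0 0)) (mkJet p q (fun _ => s) 0)
        = V.eta p * b q := by
      have hb0 : pd (u 0 0) (fun z => b (par z) * z (u 0 0)) (mkJet p q (fun _ => s) 0) = b q := by
        apply pd_eq_of_hasDerivAt
        simpa [par_update] using (hasDerivAt_id' _).const_mul (b q)
      rw [spatialPart, Finset.sum_eq_single 0, hb0, sigma_zero_zero]
      · rfl
      · intro l _ hl
        have : 0 ≠ l := by omega
        simp [pd, par_update, this]
      · simp
    have hp0 : parPart V (p, q) (fun z => b (par z) * z (u 0 0)) (mkJet p q (fun _ => s) 0)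
        = p.2.2 * parPart V (p, q) (fun z => b (par z)) (mkJet p q (fun _ => 0) 0) := by
      rw [← parPart_par_congr V (p, q) b (z := mkJet p q (fun _ => s) 0)
        (z' := mkJet p q (fun _ => 0) 0) rfl]
      simp [parPart, pd]
      ring
    have hsum : (∑ l ∈ Finset.range 7, pd (u (k + 1) 0) (sigma V l 0) (mkJet p q (fun _ => s) 0)
        * pd (u l 0) (evol κ₁ κ₂) (mkJet p q (fun _ => s) 0))
        = (du V.eta p - ((k + 1 : ℕ) : ℝ) * dx V.xi₁ p) * (b q * p.2.2)
          + ((((k + 1 : ℕ) : ℝ) + 1) * (dx (du V.eta) p + s * du (du V.eta) p)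
            - (((k + 1 : ℕ) : ℝ) + 1) * ((k + 1 : ℕ) : ℝ) / 2 * dx (dx V.xi₁) p) * a q := by
      rw [Finset.sum_eq_add (k + 1) (k + 1 + 1) (by omega), pd_top_sigma hV h₂ (by omega),
        pd_next_sigma hV h₂ h₁ (by omega), hL.top, hL.next, h₁, Dx_base_of_du_eq_zero hV.1 h₁]
      · simp
      · intro l hl hlk
        rcases lt_or_ge l (k + 1) with hlt | hge
        · rw [pd_sigma_of_lt hV (by omega)]; simp
        · rw [hL.higher l (by omega)]; simp
      · intro hmem; simp at hmem; omega
      · intro hmem; simp at hmem; omega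
    rw [hsum, hL.next, hs0, h₁] at h
    simp only [base_mkJet, par_mkJet, mkJet_u, mul_zero, sub_zero] at h
    rw [hp0] at h
    linear_combination h
  have huu : du (du V.eta) = fun _ => 0 := by
    obtain ⟨q, hq, ha⟩ : ∃ q ∈ params, a q ≠ 0 := by
      by_contra! hc
      exact one_ne_zero (hL.indep 0 1 fun q hq => by simp [hc q hq]).2
    funext p
    have : ((m : ℝ) + 1) * a q * du (du V.eta) p = 0 := by
      linear_combination key p q hq 1 - key p q hq 0
    have hm0 : (m : ℝ) + 1 ≠ 0 := by positivity
    simpa [ha, hm0] using this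
  refine ⟨huu, fun x t => ?_⟩
  -- At `u = 0` the unknown parameter terms drop out, leaving a relation between `a` and `b` whose
  -- coefficients do not depend on the parameters.
  obtain ⟨h3, h4⟩ := hL.indep (V.eta (x, t, 0))
    ((m + 1) * dx (du V.eta) (x, t, 0) - (m + 1) * m / 2 * dx (dx V.xi₁) (x, t, 0))
    fun q hq => by
      have := key (x, t, 0) q hq 0
      simp only at this
      linear_combination this
  refine ⟨h3, ?_⟩
  have hm0 : (m : ℝ) + 1 ≠ 0 := by positivity
  apply mul_left_cancel₀ hm0
  linear_combination 2 * h4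

end Determining

/-! ### Solving the determining equations -/

section Solution

variable {V : PointField} {κ₁ κ₂ : ℝ}

/-- The simpler `sigma_eq` is not available while `η_xu` and `ξ₁_xx` are unknown, nor for the
Burgers fields with `η ≠ 0` at `u = 0`. -/
theorem sigma_two_of_du_eq_zero (hV : V.IsSmooth)
    (h₂ : (Dx fun w => V.xi₂ (base w)) = fun _ => 0) (h₁ : du V.xi₁ = fun _ => 0) (z : Jet) :
    sigma V 2 0 z = dx (dx V.eta) (base z) + 2 * z (u 1 0) * dx (du V.eta) (base z)
      + z (u 1 0) ^ 2 * du (du V.eta) (base z) + z (u 2 0) * du V.eta (base z)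
      - 2 * z (u 2 0) * dx V.xi₁ (base z) - z (u 1 0) * dx (dx V.xi₁) (base z) := by
  have hη := hV.2.2.1
  have hdη := JetSmooth.base _ (contDiff_dx hη)
  have huη := JetSmooth.base _ (contDiff_du hη)
  have hdξ := JetSmooth.base _ (contDiff_dx hV.1)
  have hu : JetSmooth fun z => z (u 1 0) := .coord _
  rw [sigma_succ V 1 0, sigma_succ V 0 0, sigma_zero_zero, h₂, Dx_base hη,
    Dx_base_of_du_eq_zero hV.1 h₁]
  simp only [mul_zero, sub_zero]
  rw [Dx_sub (.add _ _ hdη (.mul _ _ hu huη)) (.mul _ _ hu hdξ),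
    Dx_add hdη (.mul _ _ hu huη), Dx_mul hu huη, Dx_mul hu hdξ, Dx_u (by simp),
    Dx_base (contDiff_dx hη), Dx_base (contDiff_du hη),
    Dx_base_of_du_eq_zero (contDiff_dx hV.1) (du_dx_eq_zero hV.1 h₁), du_dx hη]
  ring

theorem dx_eq_zero_of_line {f : ℝ × ℝ × ℝ → ℝ} (hf : ContDiff ℝ ∞ f) {t u : ℝ}
    (h : ∀ x, f (x, t, u) = 0) (x : ℝ) : dx f (x, t, u) = 0 := by
  have := dx_eq_deriv hf (x, t, u)
  simp only [h] at this
  exact this.unique (hasDerivAt_const _ _)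

theorem dt_eq_zero_of_line {f : ℝ × ℝ × ℝ → ℝ} (hf : ContDiff ℝ ∞ f) {x u : ℝ}
    (h : ∀ t, f (x, t, u) = 0) (t : ℝ) : dt f (x, t, u) = 0 := by
  have := dt_eq_deriv hf (x, t, u)
  simp only [h] at this
  exact this.unique (hasDerivAt_const _ _)

/-- The symmetries have `ξ₁` affine in `x` and independent of `t`, and `η_u` independent
of `x`. -/
theorem xi₁_eta_relations {m : ℕ} {a b : ℝ × ℝ × ℝ → ℝ} (hL : HasLeading κ₁ κ₂ m a b)
    (hS : IsSymmetry 6 (evolEq κ₁ κ₂) V) : (dt V.xi₁ = fun _ => 0) ∧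
      (dx (dx V.xi₁) = fun _ => 0) ∧ dx (du V.eta) = fun _ => 0 := by
  have hV := hS.1
  have hη := hV.2.2.1
  have h₂ := Dx_xi₂_eq_zero hL hS
  have h₁ := du_xi₁_eq_zero hL hS
  obtain ⟨huu, hrel⟩ := eta_relations hL hS
  have hη0 : ∀ x t, V.eta (x, t, 0) = 0 := fun x t => (hrel x t).1
  -- At `u = ν = 0`, `u_x = 1` and no higher derivatives, all contributions of `g₂` and `g₃` vanish;
  -- `∂Q/∂u_xx = h²/2` remains.
  have key : ∀ x t k : ℝ, 0 < k → k ^ 2 / 2 * (2 * dx (du V.eta) (x, t, 0)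
      - dx (dx V.xi₁) (x, t, 0)) - dt V.xi₁ (x, t, 0) = 0 := by
    intro x t k hk
    have h := hS.detEq_eq_zero h₂
      (z := mkJet (x, t, 0) (k, 1, 0) (fun i => if i = 0 then 1 else 0) 0)
      ⟨hk, by simp, by simp⟩
    rw [detEq, parPart, spatialPart] at h
    simp only [Finset.sum_range_succ, Finset.sum_range_zero, pd_evol, evolGrad, sigma_zero_zero,
      sigma_two_of_du_eq_zero hV h₂ h₁, g₂', g₃', evol, base_mkJet, huu, hη0,
      dx_eq_zero_of_line (contDiff_dx hη) fun x => dx_eq_zero_of_line hη (fun x => hη0 x t) x,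
      dt_eq_zero_of_line hη fun t => hη0 x t, mkJet_h, mkJet_tau, mkJet_nu, mkJet_u, mkJet_u_one,
      mkJet_u_two, mkJet_u_three, mkJet_u_four, mkJet_u_five, mkJet_u_six, if_true,
      one_ne_zero, OfNat.ofNat_ne_zero, if_false] at h
    linear_combination h
  have hm : (2 : ℝ) < m := by exact_mod_cast hL.two_lt
  have hline : ∀ x t, dx (dx V.xi₁) (x, t, 0) = 0 ∧ dx (du V.eta) (x, t, 0) = 0
      ∧ dt V.xi₁ (x, t, 0) = 0 := by
    intro x t
    have e1 := key x t 1 one_pos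
    have e2 := key x t 2 two_pos
    have e3 := (hrel x t).2
    -- The values `h = 1, 2` isolate `2 η_xu - ξ₁_xx = 0`, to be compared with `2 η_xu = m ξ₁_xx`.
    have e4 : (m - 1 : ℝ) * dx (dx V.xi₁) (x, t, 0) = 0 := by
      linear_combination (2 / 3) * e2 - (2 / 3) * e1 - e3
    have e5 : dx (dx V.xi₁) (x, t, 0) = 0 := by
      rcases mul_eq_zero.1 e4 with h | h
      · linarith
      · exact h
    rw [e5] at e1 e2 e3
    exact ⟨e5, by linarith, by linarith⟩
  -- All three functions are independent of `u`, so vanishing at `u = 0` is enough.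
  have hext : ∀ f : ℝ × ℝ × ℝ → ℝ, ContDiff ℝ ∞ f → (du f = fun _ => 0) →
      (∀ x t, f (x, t, 0) = 0) → f = fun _ => 0 := fun f hf hd h0 => by
    funext p
    exact (eq_of_du_eq_zero hf hd p.1 p.2.1 p.2.2 0).trans (h0 _ _)
  refine ⟨hext _ (contDiff_dt hV.1) ?_ fun x t => (hline x t).2.2,
    hext _ (contDiff_dx (contDiff_dx hV.1)) ?_ fun x t => (hline x t).1,
    hext _ (contDiff_dx (contDiff_du hη)) ?_ fun x t => (hline x t).2.1⟩
  · rw [du_dt hV.1, h₁, dt_zero]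
  · exact du_dx_eq_zero (contDiff_dx hV.1) (du_dx_eq_zero hV.1 h₁)
  · exact du_dx_eq_zero (contDiff_du hη) huu

theorem eq_mul_du {f : ℝ × ℝ × ℝ → ℝ} (hf : ContDiff ℝ ∞ f) (h : du (du f) = fun _ => 0)
    (h₀ : ∀ x t, f (x, t, 0) = 0) (p : ℝ × ℝ × ℝ) : f p = du f p * p.2.2 := by
  obtain ⟨x, t, r⟩ := p
  have hd : ∀ s, HasDerivAt (fun s => f (x, t, s) - du f (x, t, r) * s) 0 s := fun s => by
    have := (du_eq_deriv hf (x, t, s)).fun_sub ((hasDerivAt_id' s).const_mul (du f (x, t, r)))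
    rw [eq_of_du_eq_zero (contDiff_du hf) h x t s r] at this
    simpa using this
  have := is_const_of_deriv_eq_zero (fun s => (hd s).differentiableAt) (fun s => (hd s).deriv) r 0
  simp only [h₀] at this
  linarith

/-- The prolongation of an operator with `η = η_u u`, `ξ₁` affine in `x` and `ξ₂` depending on
`t`. -/
theorem sigma_eq (hV : V.IsSmooth) (h₂ : (Dx fun w => V.xi₂ (base w)) = fun _ => 0)
    (h₁ : du V.xi₁ = fun _ => 0) (hxx : dx (dx V.xi₁) = fun _ => 0)
    (huu : du (du V.eta) = fun _ => 0) (hxu : dx (du V.eta) = fun _ => 0)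
    (h₀ : ∀ x t, V.eta (x, t, 0) = 0) {k : ℕ} (hk : k ≤ 6) :
    sigma V k 0 = fun z => (du V.eta (base z) - k * dx V.xi₁ (base z)) * z (u k 0) := by
  have hη := contDiff_du hV.2.2.1
  have hξ := contDiff_dx hV.1
  induction k with
  | zero =>
    funext z
    rw [sigma_zero_zero]
    beta_reduce
    rw [eq_mul_du hV.2.2.1 huu h₀]
    simp [base]
  | succ k ih =>
    have hs := (JetSmooth.base _ hη).sub (.mul _ _ (.const k) (.base _ hξ))
    rw [sigma_succ, ih (by omega), h₂, Dx_mul hs (.coord _), Dx_u (by omega),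
      Dx_sub (.base _ hη) (.mul _ _ (.const _) (.base _ hξ)), Dx_mul (.const _) (.base _ hξ),
      Dx_base_of_du_eq_zero hξ (du_dx_eq_zero hV.1 h₁), Dx_base_of_du_eq_zero hV.1 h₁,
      Dx_base_of_du_eq_zero hη huu, hxu, hxx]
    funext z
    simp
    ring

/-- The determining equations at the jets with `u₁ = r`, `u₂ = s`, all further derivatives being
zero. -/
theorem detEq_explicit {m : ℕ} {a b : ℝ × ℝ × ℝ → ℝ} (hL : HasLeading κ₁ κ₂ m a b)
    (hS : IsSymmetry 6 (evolEq κ₁ κ₂) V) (x t v k τ ν : ℝ) (hq : (k, τ, ν) ∈ params) (r s : ℝ) :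
    V.zeta₁ ((x, t, v), (k, τ, ν)) * (k * r * s)
      + V.zeta₂ ((x, t, v), (k, τ, ν)) * (κ₁ * (2 * v * r ^ 2 + v ^ 2 * s - 4 * ν * r * s)
        + 2 * κ₂ * τ * (-6 * v * r ^ 3 - 9 * v ^ 2 * r * s + 18 * ν * r ^ 2 * s
          + 12 * ν * v * s ^ 2))
      + V.theta ((x, t, v), (k, τ, ν)) * (-s - κ₁ * τ * 4 * r * s
        + κ₂ * τ ^ 2 * (18 * r ^ 2 * s + 12 * v * s ^ 2))
      + du V.eta (x, t, v) * v * (r + κ₁ * τ * (2 * r ^ 2 + 2 * v * s)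
        + κ₂ * τ ^ 2 * (-6 * r ^ 3 - 18 * v * r * s + 12 * ν * s ^ 2))
      + (du V.eta (x, t, v) - dx V.xi₁ (x, t, v)) * r * (v + k ^ 2 / 2 * s
        + κ₁ * τ * (4 * v * r - 4 * ν * s)
        + κ₂ * τ ^ 2 * (-18 * v * r ^ 2 - 9 * v ^ 2 * s + 36 * ν * r * s))
      + (du V.eta (x, t, v) - 2 * dx V.xi₁ (x, t, v)) * s * (-ν + k ^ 2 / 2 * r
        + κ₁ * τ * (v ^ 2 - 4 * ν * r)
        + κ₂ * τ ^ 2 * (-9 * v ^ 2 * r + 18 * ν * r ^ 2 + 24 * ν * v * s))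
      + dt V.eta (x, t, v) - (du V.eta (x, t, v) - dt V.xi₂ (x, t, v)) * (v * r - ν * s
        + k ^ 2 / 2 * r * s + κ₁ * τ * (2 * v * r ^ 2 + v ^ 2 * s - 4 * ν * r * s)
        + κ₂ * τ ^ 2 * (-6 * v * r ^ 3 - 9 * v ^ 2 * r * s + 18 * ν * r ^ 2 * s
          + 12 * ν * v * s ^ 2)) = 0 := by
  have hV := hS.1
  have h₂ := Dx_xi₂_eq_zero hL hS
  have h₁ := du_xi₁_eq_zero hL hS
  obtain ⟨huu, hrel⟩ := eta_relations hL hS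
  obtain ⟨ht, hxx, hxu⟩ := xi₁_eta_relations hL hS
  have hσ := fun l => sigma_eq hV h₂ h₁ hxx huu hxu (fun x t => (hrel x t).1) (k := l)
  have h := hS.detEq_eq_zero h₂ (z := mkJet (x, t, v) (k, τ, ν)
    (fun i => if i = 0 then r else if i = 1 then s else 0) 0) hq
  rw [detEq, parPart, spatialPart] at h
  simp only [Finset.sum_range_succ, Finset.sum_range_zero, pd_evol, evolGrad, hσ, Nat.reduceLeDiff,
    zero_le, g₂', g₃', evol, base_mkJet,
    par_mkJet, mkJet_h, mkJet_tau, mkJet_nu, mkJet_u, mkJet_u_one, h₁, ht,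
    mkJet_u_two, mkJet_u_three, mkJet_u_four, mkJet_u_five, mkJet_u_six, if_true,
    one_ne_zero, OfNat.ofNat_ne_zero, OfNat.ofNat_ne_one, if_false, Nat.cast_ofNat, Nat.cast_one,
    Nat.cast_zero] at h
  linear_combination h

theorem eq_const_of_partials {f : ℝ × ℝ × ℝ → ℝ} (hf : ContDiff ℝ ∞ f)
    (hx : dx f = fun _ => 0) (ht : dt f = fun _ => 0) (hu : du f = fun _ => 0)
    (p q : ℝ × ℝ × ℝ) : f p = f q := by
  obtain ⟨x, t, v⟩ := p
  obtain ⟨x', t', v'⟩ := q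
  rw [eq_of_dx_eq_zero hf hx x x', eq_of_dt_eq_zero hf ht x' t t', eq_of_du_eq_zero hf hu x' t' v]

/-- The coefficient that determines `ζ₂` carries a factor `u`; continuity recovers the points with
`u = 0`. -/
theorem eq_of_forall_ne_zero {f : ℝ → ℝ} (hf : Continuous f) {c : ℝ} (h : ∀ v, v ≠ 0 → f v = c)
    (v : ℝ) : f v = c :=
  congrFun (hf.ext_on (dense_compl_singleton 0) continuous_const fun v hv => h v hv) v

theorem continuous_slice {f : Point → ℝ} (hf : ContDiffOn ℝ ∞ f phaseSpace) (x t : ℝ)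
    {q : ℝ × ℝ × ℝ} (hq : q ∈ params) : Continuous fun v => f ((x, t, v), q) :=
  hf.continuousOn.comp_continuous (by fun_prop) fun v => ⟨trivial, hq⟩

/-- The symmetries of the differential approximations are at most those of the statement. -/
theorem IsSymmetry.exists_val_eq {m : ℕ} {a b : ℝ × ℝ × ℝ → ℝ} (hL : HasLeading κ₁ κ₂ m a b)
    (hκ : κ₁ ≠ 0 ∨ κ₂ ≠ 0) (hS : IsSymmetry 6 (evolEq κ₁ κ₂) V) :
    ∃ k : ℝ × ℝ × ℝ × ℝ, ∀ p ∈ phaseSpace, V.val p = k.1 • transX.val p + k.2.1 • transT.val p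
      + k.2.2.1 • dilX.val p + k.2.2.2 • dilT.val p := by
  have hV := hS.1
  have hη := hV.2.2.1
  have h₂ := dx_xi₂_eq_zero hV (Dx_xi₂_eq_zero hL hS)
  have h₁ := du_xi₁_eq_zero hL hS
  obtain ⟨huu, hrel⟩ := eta_relations hL hS
  obtain ⟨ht, hxx, hxu⟩ := xi₁_eta_relations hL hS
  have key := detEq_explicit hL hS
  have hq : ((1 : ℝ), (1 : ℝ), (0 : ℝ)) ∈ params := ⟨by simp, by simp, by simp⟩
  have htη : dt V.eta = fun _ => 0 := by
    funext p
    linear_combination key p.1 p.2.1 p.2.2 1 1 0 hq 0 0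
  obtain ⟨β, hβ⟩ : ∃ β, ∀ p, dx V.xi₁ p = β := ⟨dx V.xi₁ 0, fun p =>
    eq_const_of_partials (contDiff_dx hV.1) hxx (by rw [← dx_dt hV.1, ht, dx_zero])
      (du_dx_eq_zero hV.1 h₁) _ _⟩
  obtain ⟨α, hα⟩ : ∃ α, ∀ p, du V.eta p = α := ⟨du V.eta 0, fun p =>
    eq_const_of_partials (contDiff_du hη) hxu (by rw [← du_dt hη, htη, du_zero]) huu _ _⟩
  simp only [hα, hβ, htη] at key
  have htξ : ∀ p, dt V.xi₂ p = β - α := by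
    have h1 : ∀ x t, dt V.xi₂ (x, t, 1) = β - α := fun x t => by
      have e := key x t 1 1 1 0 hq
      -- The five-point difference formula for the derivative at `r = 0`, exact on cubics, extracts
      -- the coefficient of `r`.
      linear_combination (2 / 3) * (e 1 0 - e (-1) 0) - (1 / 12) * (e 2 0 - e (-2) 0)
    rintro ⟨x, t, v⟩
    rw [eq_of_du_eq_zero (contDiff_dt hV.2.1) (by rw [du_dt hV.2.1, h₂.2, dt_zero]) x t v 1, h1]
  simp only [htξ] at key
  have hξ₁ : ∀ p, V.xi₁ p = V.xi₁ 0 + β * p.1 := by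
    rintro ⟨x, t, v⟩
    have hd : ∀ s, HasDerivAt (fun s => V.xi₁ (s, t, v) - β * s) 0 s := fun s => by
      have := (dx_eq_deriv hV.1 (s, t, v)).fun_sub ((hasDerivAt_id' s).const_mul β)
      simpa [hβ] using this
    have h := is_const_of_deriv_eq_zero (fun s => (hd s).differentiableAt)
      (fun s => (hd s).deriv) x 0
    have h' : V.xi₁ (0, t, v) = V.xi₁ 0 := by
      rw [eq_of_dt_eq_zero hV.1 ht 0 t 0, eq_of_du_eq_zero hV.1 h₁ 0 0 v 0]; rfl
    simp only [h'] at h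
    linarith
  have hξ₂ : ∀ p, V.xi₂ p = V.xi₂ 0 + (β - α) * p.2.1 := by
    rintro ⟨x, t, v⟩
    have hd : ∀ s, HasDerivAt (fun s => V.xi₂ (x, s, v) - (β - α) * s) 0 s := fun s => by
      have := (dt_eq_deriv hV.2.1 (x, s, v)).fun_sub ((hasDerivAt_id' s).const_mul (β - α))
      simpa [htξ] using this
    have h := is_const_of_deriv_eq_zero (fun s => (hd s).differentiableAt)
      (fun s => (hd s).deriv) t 0
    have h' : V.xi₂ (x, 0, v) = V.xi₂ 0 := by
      rw [eq_of_dx_eq_zero hV.2.1 h₂.1 x 0, eq_of_du_eq_zero hV.2.1 h₂.2 0 0 v 0]; rfl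
    simp only [h'] at h
    linarith
  have hpar : ∀ x t v k τ ν, (k, τ, ν) ∈ params → v ≠ 0 →
      V.zeta₁ ((x, t, v), (k, τ, ν)) = β * k ∧ V.zeta₂ ((x, t, v), (k, τ, ν)) = (β - α) * τ ∧
        V.theta ((x, t, v), (k, τ, ν)) = (α + β) * ν := by
    intro x t v k τ ν hq hv
    have e := key x t v k τ ν hq
    have hk : k ≠ 0 := hq.1.ne'
    have hτ : τ ≠ 0 := hq.2.1.ne'
    have hζ₂ : V.zeta₂ ((x, t, v), (k, τ, ν)) = (β - α) * τ := by
      -- The coefficient of `r²` carries the factor `κ₁` and that of `r³` the factor `κ₂`; either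
      -- one determines `ζ₂`.
      rcases hκ with hκ | hκ
      · have : κ₁ * v * (V.zeta₂ ((x, t, v), (k, τ, ν)) - (β - α) * τ) = 0 := by
          linear_combination (1 / 4) * (e 1 0 + e (-1) 0)
        have h3 : κ₁ * v ≠ 0 := mul_ne_zero hκ hv
        linarith [(mul_eq_zero.1 this).resolve_left h3]
      · have : κ₂ * τ * v * (V.zeta₂ ((x, t, v), (k, τ, ν)) - (β - α) * τ) = 0 := by
          linear_combination (-1 / 24) * (e 1 0 - e (-1) 0)
        have h3 : κ₂ * τ * v ≠ 0 := mul_ne_zero (mul_ne_zero hκ hτ) hv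
        linarith [(mul_eq_zero.1 this).resolve_left h3]
    rw [hζ₂] at e
    have hθ : V.theta ((x, t, v), (k, τ, ν)) = (α + β) * ν := by
      -- The part odd in `s` at `r = 0`, that is, the coefficient of `s`.
      linear_combination (-1 / 2) * (e 0 1 - e 0 (-1))
    rw [hθ] at e
    refine ⟨?_, hζ₂, hθ⟩
    apply mul_left_cancel₀ hk
    -- The mixed difference extracts the coefficient of `r s`.
    linear_combination (1 / 4) * (e 1 1 - e (-1) 1 - e 1 (-1) + e (-1) (-1))
  -- The last entry is `d`, since `η_u = d - b` with `b = β`.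
  refine ⟨(V.xi₁ 0, V.xi₂ 0, β, α + β), ?_⟩
  rintro ⟨⟨x, t, v⟩, ⟨k, τ, ν⟩⟩ ⟨-, hq⟩
  have hp := fun v hv => hpar x t v k τ ν hq hv
  have e1 := eq_of_forall_ne_zero (continuous_slice hV.2.2.2.1 x t hq) (fun v hv => (hp v hv).1) v
  have e2 := eq_of_forall_ne_zero (continuous_slice hV.2.2.2.2.1 x t hq)
    (fun v hv => (hp v hv).2.1) v
  have e3 := eq_of_forall_ne_zero (continuous_slice hV.2.2.2.2.2 x t hq)
    (fun v hv => (hp v hv).2.2) v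
  have e4 := eq_mul_du hη huu (fun x t => (hrel x t).1) (x, t, v)
  simp only [PointField.val, transX, transT, dilX, dilT, hξ₁ (x, t, v), hξ₂ (x, t, v), e1, e2, e3,
    e4, hα, Prod.smul_mk, Prod.mk_add_mk, smul_eq_mul, Prod.mk.injEq]
  refine ⟨⟨?_, ?_, ?_⟩, ?_, ?_, ?_⟩ <;> ring

end Solution

/-! ### The three schemes -/

theorem pd_u_evol_zero_of_lt (κ₁ : ℝ) {k : ℕ} (hk : 4 < k) :
    pd (u k 0) (evol κ₁ 0) = fun _ => 0 := by
  rcases lt_or_ge 6 k with h | h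
  · exact pd_u_evol_of_lt _ _ h
  · interval_cases k
    · rw [pd_evol]; funext z; simp [evolGrad]
    · rw [pd_evol]; funext z; simp [evolGrad]

theorem hasLeading_ftcs : HasLeading (1 / 2) 0 3
    (fun q => -(q.2.2 * q.1 ^ 2 / 12) + 1 / 2 * q.2.1 * q.2.2 ^ 2)
    (fun q => q.1 ^ 2 / 6 - q.2.1 * q.2.2) where
  two_lt := by simp
  lt_six := by simp
  higher := fun k hk => pd_u_evol_zero_of_lt _ hk
  top := by
    rw [pd_evol]; funext z; simp [evolGrad, par]
  next := by
    rw [pd_evol]; funext z; simp [evolGrad, par]; ring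
  indep := fun y w hyw => by
    -- At `ν = 0` the top coefficient vanishes, which isolates `y`.
    have h1 := hyw (1, 1, 0) ⟨by simp, by simp, by simp⟩
    have h2 := hyw (1, 1, 1) ⟨by simp, by simp, by simp⟩
    norm_num at h1 h2
    subst h1
    exact ⟨rfl, by simpa using h2⟩

theorem hasLeading_of_ne_zero {κ : ℝ} (hκ : κ ≠ 0) : HasLeading 0 κ 5
    (fun q => κ * q.2.1 ^ 2 * q.2.2 ^ 3) (fun q => κ * q.2.1 ^ 2 * (-3 * q.2.2 ^ 2)) where
  two_lt := by simp
  lt_six := by simp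
  higher := fun k hk => pd_u_evol_of_lt _ _ hk
  top := by
    rw [pd_evol]; funext z; simp [evolGrad, par]
  next := by
    rw [pd_evol]; funext z; simp [evolGrad, par]; ring
  indep := fun y w hyw => by
    -- The two coefficients are proportional to `ν³` and `ν²`, so two values of `ν` separate them.
    have h1 := hyw (1, 1, 1) ⟨by simp, by simp, by simp⟩
    have h2 := hyw (1, 1, 2) ⟨by simp, by simp, by simp⟩
    have hw : κ * w = 0 := by linear_combination (1 / 4) * h2 - h1
    have hw : w = 0 := (mul_eq_zero.1 hw).resolve_left hκ
    subst hw
    have hy : κ * y = 0 := by linear_combination (-1 / 3) * h1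
    exact ⟨(mul_eq_zero.1 hy).resolve_left hκ, rfl⟩

/-- For `κ₂ = 0` no derivative above order 4 occurs, so FTCS may be treated with the sixth
prolongation as well. -/
theorem isSymmetry_evolEq_four_iff (κ₁ : ℝ) (V : PointField) :
    IsSymmetry 4 (evolEq κ₁ 0) V ↔ IsSymmetry 6 (evolEq κ₁ 0) V := by
  have h : ∀ z, prolong 4 V (evolEq κ₁ 0) z = prolong 6 V (evolEq κ₁ 0) z := fun z => by
    rw [prolong_evolEq]
    exact prolong_evolution V (by simp) (by simp) (.evol _ _) (pd_x_evol _ _) (pd_t_evol _ _)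
      (pd_u_succ_evol _ _) (fun k hk => pd_u_evol_zero_of_lt _ hk) z
  simp only [IsSymmetry, h]

/-- The evolution form of the differential approximations. -/
theorem exists_evolEq (S : Scheme) : ∃ κ₁ κ₂ m a b, HasLeading κ₁ κ₂ m a b ∧ (κ₁ ≠ 0 ∨ κ₂ ≠ 0) ∧
    ∀ V, IsSymmetry (fdaOrder S) (fda S) V ↔ IsSymmetry 6 (evolEq κ₁ κ₂) V := by
  cases S with
  | ftcs =>
    refine ⟨_, _, _, _, _, hasLeading_ftcs, by simp, fun V => ?_⟩
    rw [fda_ftcs]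
    exact isSymmetry_evolEq_four_iff _ _
  | laxWendroff =>
    refine ⟨_, _, _, _, _, hasLeading_of_ne_zero (κ := 1 / 6) (by simp), by simp, fun V => ?_⟩
    rw [fda_laxWendroff]
    rfl
  | crankNicolson =>
    refine ⟨_, _, _, _, _, hasLeading_of_ne_zero (κ := -1 / 12) (by norm_num), by norm_num,
      fun V => ?_⟩
    rw [fda_crankNicolson]
    rfl

/-! ### The four-dimensional space of symmetries -/

/-- `a ∂_x + c ∂_t + b (x ∂_x + 2 t ∂_t - u ∂_u + h ∂_h + 2 τ ∂_τ)
+ d (-t ∂_t + u ∂_u - τ ∂_τ + ν ∂_ν)` -/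
def combination (a c b d : ℝ) : PointField where
  xi₁ := fun p => a + b * p.1
  xi₂ := fun p => c + (2 * b - d) * p.2.1
  eta := fun p => (d - b) * p.2.2
  zeta₁ := fun p => b * p.2.1
  zeta₂ := fun p => (2 * b - d) * p.2.2.1
  theta := fun p => d * p.2.2.2

theorem combination_val (a c b d : ℝ) (p : Point) : (combination a c b d).val p
    = a • transX.val p + c • transT.val p + b • dilX.val p + d • dilT.val p := by
  simp only [combination, PointField.val, transX, transT, dilX, dilT, Prod.smul_mk, Prod.mk_add_mk,
    smul_eq_mul, Prod.mk.injEq]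
  refine ⟨⟨?_, ?_, ?_⟩, ?_, ?_, ?_⟩ <;> ring

theorem combination_isSmooth (a c b d : ℝ) : (combination a c b d).IsSmooth := by
  refine ⟨?_, ?_, ?_, ?_, ?_, ?_⟩ <;> unfold combination <;> fun_prop

theorem mem_phaseSpace_one : ((0, 0, 0), (1, 1, 1)) ∈ phaseSpace :=
  ⟨trivial, by simp, by simp, by simp⟩

/-- At `x = t = u = 0`, `h = τ = ν = 1` the vector is `(a, c, 0, b, 2b - d, d)`. -/
theorem combination_injective {a c b d a' c' b' d' : ℝ}
    (h : ∀ p ∈ phaseSpace, (combination a c b d).val p = (combination a' c' b' d').val p) :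
    a = a' ∧ c = c' ∧ b = b' ∧ d = d' := by
  have := h _ mem_phaseSpace_one
  simp [combination, PointField.val] at this
  tauto

theorem dx_eq_of_hasDerivAt {f : ℝ × ℝ × ℝ → ℝ} (hf : ContDiff ℝ ∞ f) {f' : ℝ × ℝ × ℝ → ℝ}
    (h : ∀ p, HasDerivAt (fun s => f (s, p.2)) (f' p) p.1) : dx f = f' :=
  funext fun p => (dx_eq_deriv hf p).unique (h p)

theorem dt_eq_of_hasDerivAt {f : ℝ × ℝ × ℝ → ℝ} (hf : ContDiff ℝ ∞ f) {f' : ℝ × ℝ × ℝ → ℝ}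
    (h : ∀ p, HasDerivAt (fun s => f (p.1, s, p.2.2)) (f' p) p.2.1) : dt f = f' :=
  funext fun p => (dt_eq_deriv hf p).unique (h p)

theorem du_eq_of_hasDerivAt {f : ℝ × ℝ × ℝ → ℝ} (hf : ContDiff ℝ ∞ f) {f' : ℝ × ℝ × ℝ → ℝ}
    (h : ∀ p, HasDerivAt (fun s => f (p.1, p.2.1, s)) (f' p) p.2.2) : du f = f' :=
  funext fun p => (du_eq_deriv hf p).unique (h p)

theorem dx_const (a : ℝ) : dx (fun _ => a) = fun _ => 0 := by funext p; simp [dx]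

theorem eq_combination {V : PointField} {a c b d : ℝ}
    (h : ∀ p ∈ phaseSpace, V.val p = (combination a c b d).val p) :
    V.xi₁ = (combination a c b d).xi₁ ∧ V.xi₂ = (combination a c b d).xi₂ ∧
      V.eta = (combination a c b d).eta := by
  have hp : ∀ p : ℝ × ℝ × ℝ, (V.val (p, (1, 1, 1))).1
      = ((combination a c b d).val (p, (1, 1, 1))).1 := fun p => by
    rw [h _ ⟨trivial, by simp, by simp, by simp⟩]
  simp only [PointField.val, Prod.mk.injEq] at hp
  exact ⟨funext fun p => (hp p).1, funext fun p => (hp p).2.1, funext fun p => (hp p).2.2⟩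

theorem isSymmetry_of_val_eq {V : PointField} (hV : V.IsSmooth) {a c b d : ℝ}
    (h : ∀ p ∈ phaseSpace, V.val p = (combination a c b d).val p) (κ₁ κ₂ : ℝ) :
    IsSymmetry 6 (evolEq κ₁ κ₂) V := by
  refine ⟨hV, fun z hz hP => ?_⟩
  obtain ⟨e₁, e₂, e₃⟩ := eq_combination h
  have hp := h (base z, par z) ⟨trivial, hz⟩
  simp only [PointField.val, Prod.mk.injEq] at hp
  obtain ⟨-, e₄, e₅, e₆⟩ := hp
  have hx₁ : dx V.xi₁ = fun _ => b := dx_eq_of_hasDerivAt hV.1 fun p => by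
    simpa [e₁, combination] using ((hasDerivAt_id' p.1).const_mul b).const_add a
  have ht₁ : dt V.xi₁ = fun _ => 0 := dt_eq_of_hasDerivAt hV.1 fun p => by
    simpa [e₁, combination] using hasDerivAt_const _ _
  have hu₁ : du V.xi₁ = fun _ => 0 := du_eq_of_hasDerivAt hV.1 fun p => by
    simpa [e₁, combination] using hasDerivAt_const _ _
  have hx₂ : dx V.xi₂ = fun _ => 0 := dx_eq_of_hasDerivAt hV.2.1 fun p => by
    simpa [e₂, combination] using hasDerivAt_const _ _
  have ht₂ : dt V.xi₂ = fun _ => 2 * b - d := dt_eq_of_hasDerivAt hV.2.1 fun p => by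
    simpa [e₂, combination] using ((hasDerivAt_id' p.2.1).const_mul (2 * b - d)).const_add c
  have hu₂ : du V.xi₂ = fun _ => 0 := du_eq_of_hasDerivAt hV.2.1 fun p => by
    simpa [e₂, combination] using hasDerivAt_const _ _
  have ht₃ : dt V.eta = fun _ => 0 := dt_eq_of_hasDerivAt hV.2.2.1 fun p => by
    simpa [e₃, combination] using hasDerivAt_const _ _
  have hu₃ : du V.eta = fun _ => d - b := du_eq_of_hasDerivAt hV.2.2.1 fun p => by
    simpa [e₃, combination] using (hasDerivAt_id' p.2.2).const_mul (d - b)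
  have hD : (Dx fun w => V.xi₂ (base w)) = fun _ => 0 := by
    rw [Dx_base hV.2.1, hx₂, hu₂]; simp
  have hσ := fun l => sigma_eq hV hD hu₁ (by rw [hx₁, dx_const])
    (by rw [hu₃]; funext p; simp [du]) (by rw [hu₃, dx_const])
    (fun x t => by simp [e₃, combination]) (k := l)
  rw [prolong_evolEq, parPart, e₄, e₅, e₆, spatialPart,
    sigma_zero_one hV]
  simp only [evolEq] at hP
  simp only [Finset.sum_range_succ, Finset.sum_range_zero, pd_evol, evolGrad, hσ, Nat.reduceLeDiff,
    zero_le, hx₁, hu₃, ht₁,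
    hu₁, ht₂, hu₂, ht₃, combination, par, g₂', g₃', evol, Nat.cast_ofNat, Nat.cast_one,
    Nat.cast_zero] at hP ⊢
  -- The equation is homogeneous under the scalings; its weight is that of `u_t`, namely `η_u -
  -- ξ₂_t`.
  linear_combination (2 * d - 3 * b) * hP

theorem isSymmetry_iff (S : Scheme) {V : PointField} (hV : V.IsSmooth) :
    IsSymmetry (fdaOrder S) (fda S) V ↔
      ∃ a c b d, ∀ p ∈ phaseSpace, V.val p = (combination a c b d).val p := by
  obtain ⟨κ₁, κ₂, m, a, b, hL, hκ, hS⟩ := exists_evolEq S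
  rw [hS]
  constructor
  · intro h
    obtain ⟨k, hk⟩ := h.exists_val_eq hL hκ
    exact ⟨k.1, k.2.1, k.2.2.1, k.2.2.2, fun p hp => by rw [combination_val, hk p hp]⟩
  · rintro ⟨a, c, b, d, h⟩
    exact isSymmetry_of_val_eq hV h _ _

theorem combination_isSymmetry (S : Scheme) (a c b d : ℝ) :
    IsSymmetry (fdaOrder S) (fda S) (combination a c b d) :=
  (isSymmetry_iff S (combination_isSmooth a c b d)).2 ⟨a, c, b, d, fun _ _ => rfl⟩

/-! ### The symmetries of the Burgers equation -/

/-- The linear combinations of the symmetries of the Burgers equation. -/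
def burgersCombination (c : Fin 6 → ℝ) : PointField where
  xi₁ := fun p => c 0 + c 2 * p.1 + c 3 * (p.1 * p.2.1) + c 4 * p.2.1
  xi₂ := fun p => c 1 + c 2 * (2 * p.2.1) + c 3 * p.2.1 ^ 2 - c 5 * p.2.1
  eta := fun p => -(c 2 * p.2.2) + c 3 * (p.1 - p.2.1 * p.2.2) + c 4 + c 5 * p.2.2
  zeta₁ := fun _ => 0
  zeta₂ := fun _ => 0
  theta := fun p => c 5 * p.2.2.2

theorem burgersCombination_isSmooth (c : Fin 6 → ℝ) : (burgersCombination c).IsSmooth := by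
  refine ⟨?_, ?_, ?_, ?_, ?_, ?_⟩ <;> unfold burgersCombination <;> fun_prop

theorem burgersGen_eq (i : Fin 6) : burgersGen i = burgersCombination (Pi.single i 1) := by
  fin_cases i <;> simp [burgersGen, burgersCombination, transX, transT]

theorem burgersGen_sum (c : Fin 6 → ℝ) (p : Point) :
    ∑ i, c i • ((burgersGen i).val p).1 = ((burgersCombination c).val p).1 := by
  simp only [Fin.sum_univ_six, burgersGen, burgersCombination, transX, transT, PointField.val,
    Matrix.cons_val, Prod.smul_mk, Prod.mk_add_mk, smul_eq_mul, Prod.mk.injEq]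
  refine ⟨?_, ?_, ?_⟩ <;> ring

theorem burgersCombination_isSymmetry (c : Fin 6 → ℝ) :
    IsSymmetry 2 burgers (burgersCombination c) := by
  have hV := burgersCombination_isSmooth c
  refine ⟨hV, fun z _ hP => ?_⟩
  set V := burgersCombination c with hVc
  set Q : Jet → ℝ := fun z => z (u 0 0) * z (u 1 0) - z nu * z (u 2 0) with hQ
  have hb : burgers = fun z => z (u 0 1) + Q z := by funext z; simp only [burgers, hQ]; ring
  have hQs : JetSmooth Q :=
    (JetSmooth.mul _ _ (.coord _) (.coord _)).sub (.mul _ _ (.coord _) (.coord _))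
  have hpd : ∀ e, pd e Q = fun z => (if u 0 0 = e then 1 else 0) * z (u 1 0)
      + z (u 0 0) * (if u 1 0 = e then 1 else 0) - ((if nu = e then 1 else 0) * z (u 2 0)
      + z nu * (if u 2 0 = e then 1 else 0)) := fun e => by
    rw [hQ, pd_sub (.mul _ _ (.coord _) (.coord _)) (.mul _ _ (.coord _) (.coord _)),
      pd_mul (.coord _) (.coord _), pd_mul (.coord _) (.coord _)]
    simp only [pd_coord]
  have hx₁ : dx V.xi₁ = fun p => c 2 + c 3 * p.2.1 := dx_eq_of_hasDerivAt hV.1 fun p => by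
    have := (((hasDerivAt_id' p.1).const_mul (c 2)).const_add (c 0)).fun_add
      (((hasDerivAt_id' p.1).mul_const p.2.1).const_mul (c 3)) |>.add_const (c 4 * p.2.1)
    simpa [hVc, burgersCombination] using this
  have ht₁ : dt V.xi₁ = fun p => c 3 * p.1 + c 4 := dt_eq_of_hasDerivAt hV.1 fun p => by
    have := (((hasDerivAt_id' p.2.1).const_mul p.1).const_mul (c 3)).const_add (c 0 + c 2 * p.1)
      |>.fun_add ((hasDerivAt_id' p.2.1).const_mul (c 4))
    simpa [hVc, burgersCombination] using this
  have hu₁ : du V.xi₁ = fun _ => 0 := du_eq_of_hasDerivAt hV.1 fun p => by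
    simpa [hVc, burgersCombination] using hasDerivAt_const _ _
  have hx₂ : dx V.xi₂ = fun _ => 0 := dx_eq_of_hasDerivAt hV.2.1 fun p => by
    simpa [hVc, burgersCombination] using hasDerivAt_const _ _
  have ht₂ : dt V.xi₂ = fun p => 2 * c 2 + 2 * c 3 * p.2.1 - c 5 :=
    dt_eq_of_hasDerivAt hV.2.1 fun p => by
      have := ((((hasDerivAt_id' p.2.1).const_mul 2).const_mul (c 2)).const_add (c 1)).fun_add
        (((hasDerivAt_id' p.2.1).fun_pow 2).const_mul (c 3)) |>.fun_sub
        ((hasDerivAt_id' p.2.1).const_mul (c 5))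
      refine this.congr_deriv ?_
      norm_num
      ring
  have hu₂ : du V.xi₂ = fun _ => 0 := du_eq_of_hasDerivAt hV.2.1 fun p => by
    simpa [hVc, burgersCombination] using hasDerivAt_const _ _
  have hx₃ : dx V.eta = fun _ => c 3 := dx_eq_of_hasDerivAt hV.2.2.1 fun p => by
    have := ((((hasDerivAt_id' p.1).sub_const (p.2.1 * p.2.2)).const_mul (c 3)).const_add
      (-(c 2 * p.2.2))).add_const (c 4) |>.add_const (c 5 * p.2.2)
    simpa [hVc, burgersCombination] using this
  have ht₃ : dt V.eta = fun p => -(c 3 * p.2.2) := dt_eq_of_hasDerivAt hV.2.2.1 fun p => by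
    have := (((((hasDerivAt_id' p.2.1).mul_const p.2.2).const_sub p.1).const_mul (c 3)).const_add
      (-(c 2 * p.2.2))).add_const (c 4) |>.add_const (c 5 * p.2.2)
    simpa [hVc, burgersCombination] using this
  have hu₃ : du V.eta = fun p => -(c 2) - c 3 * p.2.1 + c 5 :=
    du_eq_of_hasDerivAt hV.2.2.1 fun p => by
      have := ((((hasDerivAt_id' p.2.2).const_mul (c 2)).fun_neg.fun_add
        ((((hasDerivAt_id' p.2.2).const_mul p.2.1).const_sub p.1).const_mul (c 3))).add_const
          (c 4)).fun_add ((hasDerivAt_id' p.2.2).const_mul (c 5))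
      refine this.congr_deriv ?_
      norm_num
      ring
  have hD : (Dx fun w => V.xi₂ (base w)) = fun _ => 0 := by
    rw [Dx_base hV.2.1, hx₂, hu₂]; simp
  have hxx₁ : dx (dx V.xi₁) = fun _ => 0 := dx_eq_of_hasDerivAt (contDiff_dx hV.1) fun p => by
    simpa [hx₁] using hasDerivAt_const _ _
  have hxu : dx (du V.eta) = fun _ => 0 := dx_eq_of_hasDerivAt (contDiff_du hV.2.2.1) fun p => by
    simpa [hu₃] using hasDerivAt_const _ _
  have huu : du (du V.eta) = fun _ => 0 := du_eq_of_hasDerivAt (contDiff_du hV.2.2.1) fun p => by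
    simpa [hu₃] using hasDerivAt_const _ _
  have hs₁ : sigma V 1 0 z = dx V.eta (base z) + z (u 1 0) * du V.eta (base z)
      - z (u 1 0) * dx V.xi₁ (base z) := by
    rw [sigma_succ V 0 0, sigma_zero_zero, hD, Dx_base hV.2.2.1, Dx_base_of_du_eq_zero hV.1 hu₁]
    simp
  rw [hb, prolong_evolution V (by simp) (by simp) hQs (by simp [hpd]) (by simp [hpd])
    (fun i j => by simp [hpd]) (fun k hk => ?_), parPart, spatialPart, sigma_zero_one hV]
  · have hs₂ := sigma_two_of_du_eq_zero hV hD hu₁ z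
    rw [hxx₁, hxu, huu] at hs₂
    have hs₀ : sigma V 0 0 z = V.eta (base z) := by rw [sigma_zero_zero]
    simp [Finset.sum_range_succ, hpd, hs₀, hs₁, hs₂, hx₁, ht₁, hu₁, ht₂, hu₂, hx₃, ht₃, hu₃,
      dx_const]
    simp only [burgers] at hP
    simp only [hVc, burgersCombination, base, par]
    -- The multiplier is `η_u - ξ₂_t`, read off from the coefficient of `u_t`.
    linear_combination (-3 * c 2 - 3 * c 3 * z t + 2 * c 5) * hP
  · have h0 : 0 ≠ k := by omega
    have h1 : 1 ≠ k := by omega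
    have h2 : 2 ≠ k := by omega
    simp [hpd, h0, h1, h2]

/-! ### The transformation group -/

theorem transform_mem {a c l m : ℝ} (hl : 0 < l) (hm : 0 < m) {p : Point} (hp : p ∈ phaseSpace) :
    transform a c l m p ∈ phaseSpace := by
  obtain ⟨-, h₁, h₂, h₃⟩ := hp
  exact ⟨trivial, mul_pos hl h₁, mul_pos (by positivity) h₂, mul_nonneg hm.le h₃⟩

theorem transform_transform {a c l m a' c' l' m' : ℝ} (hl : l ≠ 0) (hm : m ≠ 0) (hl' : l' ≠ 0)
    (hm' : m' ≠ 0) (p : Point) : transform a c l m (transform a' c' l' m' p)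
      = transform (l * a' + a) (l ^ 2 / m * c' + c) (l * l') (m * m') p := by
  simp only [transform, Prod.mk.injEq]
  refine ⟨⟨?_, ?_, ?_⟩, ?_, ?_, ?_⟩ <;> field_simp
  all_goals ring

theorem transform_one (p : Point) : transform 0 0 1 1 p = p := by
  simp [transform]

theorem transform_inv {a c l m : ℝ} (hl : l ≠ 0) (hm : m ≠ 0) (p : Point) :
    transform (-(l⁻¹ * a)) (-(l⁻¹ ^ 2 / m⁻¹ * c)) l⁻¹ m⁻¹ (transform a c l m p) = p := by
  rw [transform_transform (inv_ne_zero hl) (inv_ne_zero hm) hl hm, inv_mul_cancel₀ hl,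
    inv_mul_cancel₀ hm, add_neg_cancel, add_neg_cancel, transform_one]

theorem transform_inv' {a c l m : ℝ} (hl : l ≠ 0) (hm : m ≠ 0) (p : Point) :
    transform a c l m (transform (-(l⁻¹ * a)) (-(l⁻¹ ^ 2 / m⁻¹ * c)) l⁻¹ m⁻¹ p) = p := by
  rw [transform_transform hl hm (inv_ne_zero hl) (inv_ne_zero hm), mul_inv_cancel₀ hl,
    mul_inv_cancel₀ hm]
  have h₁ : l * -(l⁻¹ * a) + a = 0 := by field_simp; ring
  have h₂ : l ^ 2 / m * -(l⁻¹ ^ 2 / m⁻¹ * c) + c = 0 := by field_simp; ring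
  rw [h₁, h₂, transform_one]

/-- `transform a c l m` as a permutation of the space of the variables. -/
def transformPerm (a c : ℝ) {l m : ℝ} (hl : 0 < l) (hm : 0 < m) : Equiv.Perm phaseSpace where
  toFun p := ⟨transform a c l m p, transform_mem hl hm p.2⟩
  invFun p := ⟨transform (-(l⁻¹ * a)) (-(l⁻¹ ^ 2 / m⁻¹ * c)) l⁻¹ m⁻¹ p,
    transform_mem (inv_pos.2 hl) (inv_pos.2 hm) p.2⟩
  left_inv p := Subtype.ext (transform_inv hl.ne' hm.ne' p)
  right_inv p := Subtype.ext (transform_inv' hl.ne' hm.ne' p)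

@[simp] theorem coe_transformPerm (a c : ℝ) {l m : ℝ} (hl : 0 < l) (hm : 0 < m) (p : phaseSpace) :
    (transformPerm a c hl hm p : Point) = transform a c l m p := rfl

theorem transformPerm_mul (a c a' c' : ℝ) {l m l' m' : ℝ} (hl : 0 < l) (hm : 0 < m) (hl' : 0 < l')
    (hm' : 0 < m') : transformPerm a c hl hm * transformPerm a' c' hl' hm'
      = transformPerm (l * a' + a) (l ^ 2 / m * c' + c) (mul_pos hl hl') (mul_pos hm hm') :=
  Equiv.ext fun p => Subtype.ext
    (transform_transform hl.ne' hm.ne' hl'.ne' hm'.ne' p)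

theorem transformPerm_inv (a c : ℝ) {l m : ℝ} (hl : 0 < l) (hm : 0 < m) :
    (transformPerm a c hl hm)⁻¹ = transformPerm (-(l⁻¹ * a)) (-(l⁻¹ ^ 2 / m⁻¹ * c))
      (inv_pos.2 hl) (inv_pos.2 hm) :=
  Equiv.ext fun _ => rfl

theorem transformPerm_one : transformPerm 0 0 one_pos one_pos = 1 :=
  Equiv.ext fun p => Subtype.ext (transform_one p)

theorem transform_injective {a c l m a' c' l' m' : ℝ}
    (h : ∀ p : phaseSpace, transform a c l m p = transform a' c' l' m' p) :
    a = a' ∧ c = c' ∧ l = l' ∧ m = m' := by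
  have := h ⟨_, mem_phaseSpace_one⟩
  simp [transform] at this
  tauto

/-! ### Integrating the symmetries to flows -/

theorem hasDerivAt_exp_mul (β s : ℝ) :
    HasDerivAt (fun r => Real.exp (β * r)) (β * Real.exp (β * s)) s := by
  have := ((hasDerivAt_id' s).const_mul β).exp
  simpa [mul_comm] using this

/-- Solutions of `y' = a + β y` are affine functions of their initial values. -/
theorem exists_affine_flow (a β s : ℝ) : ∃ i : ℝ, ∀ y : ℝ → ℝ,
    (∀ r, HasDerivAt y (a + β * y r) r) → y s = Real.exp (β * s) * y 0 + i := by
  -- Variation of constants; the integral form also covers `β = 0`. The shift does not involve `y`,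
  -- so it is common to all orbits.
  refine ⟨Real.exp (β * s) * ∫ r in (0 : ℝ)..s, a * Real.exp (-β * r), fun y hy => ?_⟩
  have hc : Continuous fun r => a * Real.exp (-β * r) := by fun_prop
  have hd : ∀ r, HasDerivAt (fun r => Real.exp (-β * r) * y r
      - ∫ q in (0 : ℝ)..r, a * Real.exp (-β * q)) 0 r := fun r => by
    have h₁ := (hasDerivAt_exp_mul (-β) r).fun_mul (hy r)
    have h₂ := intervalIntegral.integral_hasDerivAt_right (hc.intervalIntegrable 0 r)
      hc.stronglyMeasurable.stronglyMeasurableAtFilter hc.continuousAt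
    refine (h₁.fun_sub h₂).congr_deriv ?_
    ring
  have h := is_const_of_deriv_eq_zero (fun r => (hd r).differentiableAt)
    (fun r => (hd r).deriv) s 0
  simp only [mul_zero, Real.exp_zero, one_mul, intervalIntegral.integral_same, sub_zero] at h
  have he : Real.exp (β * s) * Real.exp (-β * s) = 1 := by
    rw [← Real.exp_add]; simp
  linear_combination Real.exp (β * s) * h - y s * he

theorem exists_linear_flow (β s : ℝ) (y : ℝ → ℝ) (hy : ∀ r, HasDerivAt y (β * y r) r) :
    y s = Real.exp (β * s) * y 0 := by
  have hd : ∀ r, HasDerivAt (fun r => Real.exp (-β * r) * y r) 0 r := fun r => by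
    refine ((hasDerivAt_exp_mul (-β) r).fun_mul (hy r)).congr_deriv ?_
    ring
  have h := is_const_of_deriv_eq_zero (fun r => (hd r).differentiableAt)
    (fun r => (hd r).deriv) s 0
  simp only [mul_zero, Real.exp_zero, one_mul] at h
  have he : Real.exp (β * s) * Real.exp (-β * s) = 1 := by
    rw [← Real.exp_add]; simp
  linear_combination Real.exp (β * s) * h - y s * he

theorem IsFlow.apply_zero {V : PointField} {φ : ℝ → Equiv.Perm phaseSpace} (hφ : IsFlow V φ) :
    φ 0 = 1 := by
  have := hφ.1 0 0
  rw [add_zero] at this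
  exact left_eq_mul.1 this

/-- The one-parameter groups of the symmetries consist of transformations of the stated form. -/
theorem IsFlow.exists_transformPerm {V : PointField} {φ : ℝ → Equiv.Perm phaseSpace}
    (hφ : IsFlow V φ) {a c b d : ℝ}
    (h : ∀ p ∈ phaseSpace, V.val p = (combination a c b d).val p) (s : ℝ) :
    ∃ (α γ l m : ℝ) (hl : 0 < l) (hm : 0 < m), φ s = transformPerm α γ hl hm := by
  obtain ⟨α, hα⟩ := exists_affine_flow a b s
  obtain ⟨γ, hγ⟩ := exists_affine_flow c (2 * b - d) s
  refine ⟨α, γ, Real.exp (b * s), Real.exp (d * s), Real.exp_pos _, Real.exp_pos _, ?_⟩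
  refine Equiv.ext fun p => Subtype.ext ?_
  have hd : ∀ r, HasDerivAt (fun r => (φ r p : Point)) ((combination a c b d).val (φ r p)) r :=
    fun r => by rw [← h _ (φ r p).2]; exact hφ.2 p r
  have h0 : (φ 0 p : Point) = p := by rw [hφ.apply_zero]; rfl
  have hd₁ := fun r => (hd r).fst
  have hd₂ := fun r => (hd r).snd
  have e₁ := hα _ fun r => (hd₁ r).fst
  have e₂ := hγ _ fun r => (hd₁ r).snd.fst
  have e₃ := exists_linear_flow (d - b) s _ fun r => (hd₁ r).snd.snd
  have e₄ := exists_linear_flow b s _ fun r => (hd₂ r).fst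
  have e₅ := exists_linear_flow (2 * b - d) s _ fun r => (hd₂ r).snd.fst
  have e₆ := exists_linear_flow d s _ fun r => (hd₂ r).snd.snd
  have x₁ : Real.exp ((2 * b - d) * s) = Real.exp (b * s) ^ 2 / Real.exp (d * s) := by
    rw [sq, ← Real.exp_add, ← Real.exp_sub]; ring_nf
  have x₂ : Real.exp ((d - b) * s) = Real.exp (d * s) / Real.exp (b * s) := by
    rw [← Real.exp_sub]; ring_nf
  rw [h0] at e₁ e₂ e₃ e₄ e₅ e₆
  rw [coe_transformPerm, transform, ← x₁, ← x₂, ← e₁, ← e₂, ← e₃, ← e₄, ← e₅, ← e₆]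

theorem isFlow_translation (a c : ℝ) : IsFlow (combination a c 0 0)
    fun s => transformPerm (s * a) (s * c) one_pos one_pos := by
  refine ⟨fun s r => ?_, fun p s => ?_⟩
  · rw [transformPerm_mul]
    refine Equiv.ext fun p => Subtype.ext ?_
    simp only [coe_transformPerm]
    congr 1 <;> ring
  · have h : ∀ w y : ℝ, HasDerivAt (fun r => y + r * w) w s := fun w y => by
      simpa using ((hasDerivAt_id' s).mul_const w).const_add y
    have hc : ∀ y : ℝ, HasDerivAt (fun _ : ℝ => y) 0 s := fun y => hasDerivAt_const _ _
    simpa [combination, PointField.val, transform] using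
      ((h a p.1.1.1).prodMk ((h c p.1.1.2.1).prodMk (hc p.1.1.2.2))).prodMk
        ((hc p.1.2.1).prodMk ((hc p.1.2.2.1).prodMk (hc p.1.2.2.2)))

theorem isFlow_scaling (b d : ℝ) : IsFlow (combination 0 0 b d)
    fun s => transformPerm 0 0 (Real.exp_pos (b * s)) (Real.exp_pos (d * s)) := by
  refine ⟨fun s r => ?_, fun p s => ?_⟩
  · rw [transformPerm_mul]
    refine Equiv.ext fun p => Subtype.ext ?_
    simp only [coe_transformPerm, mul_zero, add_zero]
    rw [← Real.exp_add, ← Real.exp_add, mul_add, mul_add]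
  · have x₁ : ∀ r, Real.exp (b * r) ^ 2 / Real.exp (d * r) = Real.exp ((2 * b - d) * r) := by
      intro r
      rw [sq, ← Real.exp_add, ← Real.exp_sub]; ring_nf
    have x₂ : ∀ r, Real.exp (d * r) / Real.exp (b * r) = Real.exp ((d - b) * r) := by
      intro r
      rw [← Real.exp_sub]; ring_nf
    have h : ∀ β y : ℝ, HasDerivAt (fun r => Real.exp (β * r) * y) (β * (Real.exp (β * s) * y)) s :=
      fun β y => by
        simpa [mul_assoc] using (hasDerivAt_exp_mul β s).mul_const y
    simpa [combination, PointField.val, transform, x₁, x₂] using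
      ((h b p.1.1.1).prodMk ((h (2 * b - d) p.1.1.2.1).prodMk (h (d - b) p.1.1.2.2))).prodMk
        ((h b p.1.2.1).prodMk ((h (2 * b - d) p.1.2.2.1).prodMk (h d p.1.2.2.2)))

/-- The stated maps are closed under products and inverses and contain all flows. Conversely, each
is a translation after a scaling, and both factors are time-one maps, the scaling with rates `log l`
and `log m`. -/
theorem mem_symmetryGroup_iff (S : Scheme) (g : Equiv.Perm phaseSpace) :
    g ∈ symmetryGroup (fdaOrder S) (fda S) ↔
      ∃ (a c l m : ℝ) (hl : 0 < l) (hm : 0 < m), g = transformPerm a c hl hm := by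
  constructor
  · intro hg
    induction hg using Subgroup.closure_induction with
    | mem g hg =>
      obtain ⟨V, hV, φ, hφ, s, rfl⟩ := hg
      obtain ⟨a, c, b, d, h⟩ := (isSymmetry_iff S hV.1).1 hV
      exact hφ.exists_transformPerm h s
    | one => exact ⟨0, 0, 1, 1, one_pos, one_pos, transformPerm_one.symm⟩
    | mul g g' _ _ h h' =>
      obtain ⟨a, c, l, m, hl, hm, rfl⟩ := h
      obtain ⟨a', c', l', m', hl', hm', rfl⟩ := h'
      exact ⟨_, _, _, _, _, _, transformPerm_mul ..⟩
    | inv g _ h =>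
      obtain ⟨a, c, l, m, hl, hm, rfl⟩ := h
      exact ⟨_, _, _, _, _, _, transformPerm_inv ..⟩
  · rintro ⟨a, c, l, m, hl, hm, rfl⟩
    have h₁ : transformPerm a c one_pos one_pos ∈ symmetryGroup (fdaOrder S) (fda S) :=
      Subgroup.subset_closure ⟨_, combination_isSymmetry S a c 0 0, _, isFlow_translation a c, 1,
        by simp⟩
    have h₂ : transformPerm 0 0 hl hm ∈ symmetryGroup (fdaOrder S) (fda S) :=
      Subgroup.subset_closure ⟨_, combination_isSymmetry S 0 0 (Real.log l) (Real.log m), _,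
        isFlow_scaling (Real.log l) (Real.log m), 1, by simp [Real.exp_log hl, Real.exp_log hm]⟩
    have := mul_mem h₁ h₂
    rw [transformPerm_mul] at this
    simpa using this

end BurgersFDA

end

/-! ### Assembling the theorem -/

theorem mainTheorem2 :
    -- the Burgers equation has the six symmetries
    (∀ i : Fin 6, BurgersFDA.IsSymmetry 2 BurgersFDA.burgers (BurgersFDA.burgersGen i)) ∧
    ∀ S : BurgersFDA.Scheme,
      -- the solutions of the determining equations form a 4-dimensional space
      (∀ V : BurgersFDA.PointField, V.IsSmooth →
        (BurgersFDA.IsSymmetry (BurgersFDA.fdaOrder S) (BurgersFDA.fda S) V ↔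
          ∃! k : ℝ × ℝ × ℝ × ℝ, ∀ p ∈ BurgersFDA.phaseSpace,
            V.val p = k.1 • BurgersFDA.transX.val p + k.2.1 • BurgersFDA.transT.val p
              + k.2.2.1 • BurgersFDA.dilX.val p + k.2.2.2 • BurgersFDA.dilT.val p)) ∧
      -- the group that they generate is a 4-parameter group
      (∀ g : Equiv.Perm BurgersFDA.phaseSpace,
        g ∈ BurgersFDA.symmetryGroup (BurgersFDA.fdaOrder S) (BurgersFDA.fda S) ↔
          ∃! k : ℝ × ℝ × ℝ × ℝ, 0 < k.2.2.1 ∧ 0 < k.2.2.2 ∧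
            ∀ p : BurgersFDA.phaseSpace,
              (g p : BurgersFDA.Point)
                = BurgersFDA.transform k.1 k.2.1 k.2.2.1 k.2.2.2 p) ∧
      -- the projective and the Galilean symmetry are lost, however `h, τ, ν` are transformed
      (∀ c : Fin 6 → ℝ,
        (∃ V : BurgersFDA.PointField,
          BurgersFDA.IsSymmetry (BurgersFDA.fdaOrder S) (BurgersFDA.fda S) V ∧
            ∀ p ∈ BurgersFDA.phaseSpace,
              (V.val p).1 = ∑ i, c i • ((BurgersFDA.burgersGen i).val p).1) ↔
          c 3 = 0 ∧ c 4 = 0) := by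
  refine ⟨fun i => ?_, fun S => ⟨fun V hV => ?_, fun g => ?_, fun c => ?_⟩⟩
  · rw [BurgersFDA.burgersGen_eq]
    exact BurgersFDA.burgersCombination_isSymmetry _
  · simp only [← BurgersFDA.combination_val]
    rw [BurgersFDA.isSymmetry_iff S hV]
    constructor
    · rintro ⟨a, c, b, d, h⟩
      refine ⟨(a, c, b, d), h, ?_⟩
      rintro ⟨a', c', b', d'⟩ h'
      obtain ⟨rfl, rfl, rfl, rfl⟩ := BurgersFDA.combination_injective
        fun p hp => (h' p hp).symm.trans (h p hp)
      rfl
    · rintro ⟨⟨a, c, b, d⟩, h, -⟩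
      exact ⟨a, c, b, d, h⟩
  · rw [BurgersFDA.mem_symmetryGroup_iff]
    constructor
    · rintro ⟨a, c, l, m, hl, hm, rfl⟩
      refine ⟨(a, c, l, m), ⟨hl, hm, fun p => rfl⟩, ?_⟩
      rintro ⟨a', c', l', m'⟩ ⟨-, -, h⟩
      obtain ⟨rfl, rfl, rfl, rfl⟩ := BurgersFDA.transform_injective h
      rfl
    · rintro ⟨⟨a, c, l, m⟩, ⟨hl, hm, h⟩, -⟩
      exact ⟨a, c, l, m, hl, hm, Equiv.ext fun p => Subtype.ext (h p)⟩
  · simp only [BurgersFDA.burgersGen_sum]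
    constructor
    · rintro ⟨V, hV, h⟩
      obtain ⟨a, e, b, d, hk⟩ := (BurgersFDA.isSymmetry_iff S hV.1).1 hV
      -- Only the `∂_x` components are compared: in a symmetry they do not depend on `t`, which
      -- excludes the terms `x t` and `t`.
      have key : ∀ x t : ℝ, a + b * x = c 0 + c 2 * x + c 3 * (x * t) + c 4 * t := fun x t => by
        have hp : ((x, t, 0), (1, 1, 1)) ∈ BurgersFDA.phaseSpace :=
          ⟨trivial, by simp, by simp, by simp⟩
        have := h _ hp
        rw [hk _ hp] at this
        exact congrArg Prod.fst this
      have h00 := key 0 0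
      have h01 := key 0 1
      have h10 := key 1 0
      have h11 := key 1 1
      constructor
      · linear_combination h10 + h01 - h00 - h11
      · linear_combination h00 - h01
    · rintro ⟨h3, h4⟩
      -- The surviving Burgers scalings `L₃` and `L₆` extend to `dilX` and `dilT`, hence `b = c 2`
      -- and `d = c 5`.
      refine ⟨_, BurgersFDA.combination_isSymmetry S (c 0) (c 1) (c 2) (c 5), fun p _ => ?_⟩
      simp only [BurgersFDA.combination, BurgersFDA.burgersCombination, BurgersFDA.PointField.val,
        h3, h4, Prod.mk.injEq]
      refine ⟨?_, ?_, ?_⟩ <;> ring
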